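/- Let $d\ge 0$. For a path $\gamma:[0,1]\to\mathbb{R}^d$ of finite length $L$ we say that $\gamma$ is a $\mathcal C^{r}$ path ($r\ge1$) at natural parametrization if $\gamma\in\mathcal C^r([0,1])$ and $|\dot\gamma(t)|=L$ for all $t\in[0,1]$ (derivatives at the end points are one-sided). Its signature is the family $X(\gamma)=(C_\gamma(w))_w$ of all iterated integrals $$C_\gamma(i_1,\dots,i_n)=\int_{0<u_1<\dots<u_n<1}d\gamma^{(i_1)}_{u_1}\cdots d\gamma^{(i_n)}_{u_n},\qquad C_\gamma(\emptyset)=1,$$ over words $w=(i_1,\dots,i_n)$ in the letters $1,\dots,d$. **(1) Determination.** Let $k\ge1$, and let $\gamma,\tilde\gamma$ be $\mathcal C^{k+1}$ paths in $\mathbb{R}^d$ at natural parametrization. If $X(\gamma)=X(\tilde\gamma)$, then $\gamma^{(m)}(1)=\tilde\gamma^{(m)}(1)$ for all $1\le m\le k+1$. **(2) Explicit recovery.** There are real polynomials $Q_{m,i}$ ($m\ge0$, $1\le i\le d$), depending only on $d$, where $Q_{m,i}$ involves only the coordinates of $m+1$ vectors $a_0,\dots,a_m\in\mathbb{R}^d$,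 such that the following holds for every $k\ge1$ and every $\mathcal C^{k+1}$ path $\gamma$ in $\mathbb{R}^d$ at natural parametrization with length $L>0$. (a) For every $\lambda>0$ the series $$c_\lambda=\sum_{n\ge0}\lambda^{2n}\sum_{i_1,\dots,i_n}C_\gamma(i_1,i_1,\dots,i_n,i_n),\qquad s_\lambda^{(a)}=\sum_{n\ge0}\lambda^{2n+1}\sum_{i_1,\dots,i_n}C_\gamma(i_1,i_1,\dots,i_n,i_n,a)\quad(1\le a\le d)$$ converge absolutely. The Cartan development of $\lambda\gamma$, i.e. a solution on $[0,1]$ of $d\Gamma_\lambda=\begin{pmatrix}0&\lambda\,d\gamma\\ \lambda\,d\gamma^T&0\end{pmatrix}\Gamma_\lambda$, $\Gamma_\lambda(0)=I$, exists, and every such solution satisfies $\Gamma_\lambda(1)(0,\dots,0,1)^T=(s_\lambda,c_\lambda)^T$. Put $\rho_\lambda(1)=\operatorname{arcosh}c_\lambda$ and $\eta_\lambda(1)=s_\lambda/|s_\lambda|$ (with $\eta_\lambda(1)=0$ if $s_\lambda=0$), which depend only on $X(\gamma)$ and $\lambda$; then $s_\lambda=\eta_\lambda(1)\sinh\rho_\lambda(1)$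 and $c_\lambda=\cosh\rho_\lambda(1)$. (b) $\lim_{\lambda\to+\infty}\rho_\lambda(1)/\lambda=L$. (c) Let $\theta=\dot\gamma/L$, $P=I+\theta\theta^T$, and define on $[0,1]$ the functions $A_0=\theta$ and $$A_{n+1}=-P^{-1}\Big(A_n'+\sum_{j=1}^{n}A_j\,\theta^TA_{n+1-j}\Big),\qquad 0\le n\le k-1.$$ Then for every $0\le n\le k$ $$\lim_{\lambda\to+\infty}(\lambda L)^{n}\Big(\eta_\lambda(1)-\sum_{j=0}^{n-1}\frac{A_j(1)}{(\lambda L)^{j}}\Big)=A_n(1),$$ that is, $\eta_\lambda(1)=A_0(1)+\frac{A_1(1)}{\lambda L}+\dots+\frac{A_k(1)}{(\lambda L)^k}+o(\lambda^{-k})$ as $\lambda\to+\infty$. (d) For every $0\le m\le k$ and $1\le i\le d$, the $i$-th coordinate of $\gamma^{(m+1)}(1)$ equals $L\,Q_{m,i}\big(A_0(1),\dots,A_m(1)\big)$. -/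

import Mathlib

open Set Filter Topology MeasureTheory
open scoped Matrix

noncomputable section

namespace HypSig

/-- `ℝᵈ` with the Euclidean norm. -/
abbrev E (d : ℕ) : Type := EuclideanSpace ℝ (Fin d)

/-- The velocity `γ'(t)` of a path `γ : [0,1] → ℝᵈ` (one-sided at the two end points). Paths are
functions on `ℝ` of which only the restriction to `[0,1]` matters. -/
def velocity {d : ℕ} (γ : ℝ → E d) (t : ℝ) : E d := derivWithin γ (Icc 0 1) t

/-- The length of `γ : [0,1] → ℝᵈ`: the supremum over all partitions of the sums of the Euclidean
norms of the increments. -/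
def pathLength {d : ℕ} (γ : ℝ → E d) : ℝ := (eVariationOn γ (Icc 0 1)).toReal

/-- `γ` is a `C^r` path at natural parametrization: it is of class `C^r` on `[0,1]` and its speed
is constant, equal to its length. -/
structure IsNaturalPath {d : ℕ} (r : ℕ) (γ : ℝ → E d) : Prop where
  contDiffOn : ContDiffOn ℝ r γ (Icc 0 1)
  speed : ∀ t ∈ Icc (0 : ℝ) 1, ‖velocity γ t‖ = pathLength γ

/-- Iterated integrals over `0 < u₁ < ⋯ < uₙ < t`, the word being read from its last letter, which
belongs to the outermost variable `uₙ`. -/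
def iterInt {d : ℕ} (γ : ℝ → E d) : List (Fin d) → ℝ → ℝ
  | [], _ => 1
  | i :: w, t => ∫ u in (0 : ℝ)..t, iterInt γ w u * velocity γ u i

/-- The signature of `γ`, as the family of the coefficients
`C_γ(i₁, …, iₙ) = ∫_{0 < u₁ < ⋯ < uₙ < 1} dγ^{(i₁)}(u₁) ⋯ dγ^{(iₙ)}(uₙ)` of a
noncommutative formal power series. -/
def signature {d : ℕ} (γ : ℝ → E d) (w : List (Fin d)) : ℝ := iterInt γ w.reverse 1

/-- The matrix `F(x)` with blocks `0, x, xᵀ, 0`. -/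
def hypGen {d : ℕ} (x : E d) : Matrix (Fin d ⊕ Unit) (Fin d ⊕ Unit) ℝ :=
  Matrix.fromBlocks 0 (Matrix.of fun i _ => x i) (Matrix.of fun _ j => x j) 0

/-- `Γ` is the Cartan development of `γ` on `[0,1]`: `dΓ = F(dγ) Γ` and `Γ(0) = I`. -/
structure IsCartanDevelopment {d : ℕ} (γ : ℝ → E d)
    (Γ : ℝ → Matrix (Fin d ⊕ Unit) (Fin d ⊕ Unit) ℝ) : Prop where
  init : Γ 0 = 1
  ode : ∀ t ∈ Icc (0 : ℝ) 1, ∀ a b,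
    HasDerivWithinAt (fun s => Γ s a b) ((hypGen (velocity γ t) * Γ t) a b) (Icc 0 1) t

/-- The base point `o = (0, …, 0, 1)` of the hyperboloid. -/
def basePoint (d : ℕ) : Fin d ⊕ Unit → ℝ := Sum.elim 0 1

/-- The polar coordinate `ρ ≥ 0` of the point `(η sinh ρ, cosh ρ)` of the hyperboloid. -/
def polarRadius {d : ℕ} (x : Fin d ⊕ Unit → ℝ) : ℝ := Real.arcosh (x (Sum.inr ()))

/-- The polar coordinate `η` (a unit vector) of the point `(η sinh ρ, cosh ρ)` of the hyperboloid,
with the convention `η = 0` at the base point. -/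
def polarDirection {d : ℕ} (x : Fin d ⊕ Unit → ℝ) : E d :=
  ‖(WithLp.toLp 2 fun i => x (Sum.inl i) : E d)‖⁻¹ • WithLp.toLp 2 fun i => x (Sum.inl i)

/-- The word `(i₁, i₁, i₂, i₂, …, iₙ, iₙ)`. -/
def doubledWord {d n : ℕ} (i : Fin n → Fin d) : List (Fin d) :=
  (List.ofFn i).flatMap fun a => [a, a]

/-- The part of degree `2n` (in the last coordinate) or `2n + 1` (in the others) of the point of
`ℝ^{d+1}` that is read off from the signature `X` at the scale `l`; recall
`C_{lγ}(w) = l^{|w|} C_γ(w)`. -/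
def endTerm {d : ℕ} (X : List (Fin d) → ℝ) (l : ℝ) (n : ℕ) : Fin d ⊕ Unit → ℝ :=
  Sum.elim (fun a => l ^ (2 * n + 1) * ∑ i : Fin n → Fin d, X (doubledWord i ++ [a]))
    (fun _ => l ^ (2 * n) * ∑ i : Fin n → Fin d, X (doubledWord i))

/-- The point of `ℝ^{d+1}` that is read off from the signature `X` at the scale `l`. -/
def endPoint {d : ℕ} (X : List (Fin d) → ℝ) (l : ℝ) : Fin d ⊕ Unit → ℝ :=
  ∑' n, endTerm X l n

/-- The unit tangent `γ'(t) / L`, where `L` is the length. -/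
def tangent {d : ℕ} (γ : ℝ → E d) (t : ℝ) : E d := (pathLength γ)⁻¹ • velocity γ t

/-- The matrix `P(t) = I + θ(t) θ(t)ᵀ`, `θ` the unit tangent. -/
def projMat {d : ℕ} (γ : ℝ → E d) (t : ℝ) : Matrix (Fin d) (Fin d) ℝ :=
  1 + Matrix.vecMulVec (fun i => tangent γ t i) (fun i => tangent γ t i)

/-- The coefficients `A₀ = θ`,
`A_{n+1} = - P⁻¹ (A_n' + ∑_{j=1}^{n} A_j θᵀ A_{n+1-j})`, as functions on `[0,1]`. -/
def coeffA {d : ℕ} (γ : ℝ → E d) : ℕ → ℝ → E d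
  | 0 => tangent γ
  | n + 1 => fun t =>
      - Matrix.toEuclideanLin (projMat γ t)⁻¹
        (derivWithin (coeffA γ n) (Icc 0 1) t +
          ∑ j : Fin n, (inner ℝ (tangent γ t) (coeffA γ (n - j) t)) • coeffA γ (j + 1) t)
  decreasing_by all_goals omega

end HypSig

end

/-! Applying the Cartan development of `λγ` to the base point gives a curve `(s, c)` on the
hyperboloid with `s' = μ c θ`, `c' = μ ⟨θ, s⟩`, where `θ` is the unit tangent and `μ = λL`. The
equation is linear and its Picard terms are exactly the signature sums over doubled words, so the
end point is a function of the signature (`hasSum_endTerm`).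

In the Klein model `y = s / c` solves the Riccati equation `y' = μ (θ - ⟨θ, y⟩ y)`. For large `μ`
this is a singular perturbation: `y = θ` is the attracting equilibrium, with linearisation `-μ (I +
θθᵀ) = -μ P`. Substituting `y = ∑ Aₙ μ⁻ⁿ` and comparing powers of `μ` gives the recursion for `Aₙ`.
The rescaled remainders solve damped equations (`hasDerivWithinAt_rem`). Their initial layer is only
polynomially large in `μ` and decays exponentially, so near `t = 1` they converge to the equilibrium
of the limiting forcing, which is the next coefficient (`tendsto_of_damped`, `tendsto_rem`). Since
`log c(1)` equals `μ` up to a bounded error, `ρ / λ → L`, and replacing `s / c` by `s / |s|` costs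
only an exponentially small error (`tendsto_direction`).

Solved for `Aₙ'`, the recursion is polynomial in `A₀, …, A_{n+1}`. Iterating it expresses every
derivative of `θ` as a polynomial in the coefficients (`iteratedDerivWithin_eq`). Uniqueness of
limits then makes the length, the coefficients at `1` and the derivatives at `1` functions of the
signature. -/

noncomputable section

namespace HypSig

/-! ### Linear differential equations: the Picard series and uniqueness. -/

section Picard

variable {V : Type*} [NormedAddCommGroup V] [NormedSpace ℝ V]

/-- The terms of the Picard series of the linear equation `x' = A x`, `x 0 = x₀`. -/
def picardTerm (A : ℝ → V →L[ℝ] V) (x₀ : V) : ℕ → ℝ → V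
  | 0, _ => x₀
  | n + 1, t => ∫ u in (0 : ℝ)..t, A u (picardTerm A x₀ n u)

variable {A : ℝ → V →L[ℝ] V} {x₀ : V} {K : ℝ}

theorem continuous_picardTerm (hA : Continuous A) (n : ℕ) : Continuous (picardTerm A x₀ n) := by
  induction n with
  | zero => exact continuous_const
  | succ n ih =>
    exact intervalIntegral.continuous_primitive
      (fun a b => (hA.clm_apply ih).intervalIntegrable a b) 0

theorem hasDerivAt_picardTerm_succ [CompleteSpace V] (hA : Continuous A) (n : ℕ) (t : ℝ) :
    HasDerivAt (picardTerm A x₀ (n + 1)) (A t (picardTerm A x₀ n t)) t :=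
  (hA.clm_apply (continuous_picardTerm hA n)).integral_hasStrictDerivAt 0 t |>.hasDerivAt

theorem norm_picardTerm_le (hA : Continuous A) (hK : ∀ t, ‖A t‖ ≤ K) (n : ℕ) (t : ℝ) :
    ‖picardTerm A x₀ n t‖ ≤ ‖x₀‖ * ((K * |t|) ^ n / n.factorial) := by
  have hK0 : 0 ≤ K := (norm_nonneg _).trans (hK 0)
  induction n generalizing t with
  | zero => simp [picardTerm]
  | succ n ih =>
    have hc : Continuous fun u => A u (picardTerm A x₀ n u) :=
      hA.clm_apply (continuous_picardTerm hA n)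
    calc ‖picardTerm A x₀ (n + 1) t‖
        ≤ ∫ u in uIoc 0 t, ‖A u (picardTerm A x₀ n u)‖ :=
          intervalIntegral.norm_integral_le_integral_norm_uIoc
      _ ≤ ∫ u in uIoc 0 t, ‖x₀‖ * K ^ (n + 1) / n.factorial * |u - 0| ^ n := by
          refine setIntegral_mono ?_ ?_ fun u => ?_
          · exact (hc.norm.integrableOn_uIcc).mono_set uIoc_subset_uIcc
          · exact (Continuous.integrableOn_uIcc (by fun_prop)).mono_set uIoc_subset_uIcc
          · calc ‖A u (picardTerm A x₀ n u)‖ ≤ K * (‖x₀‖ * ((K * |u|) ^ n / n.factorial)) :=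
                  (A u).le_of_opNorm_le_of_le (hK u) (ih u)
              _ = ‖x₀‖ * K ^ (n + 1) / n.factorial * |u - 0| ^ n := by
                  rw [sub_zero, mul_pow]; ring
      _ = ‖x₀‖ * ((K * |t|) ^ (n + 1) / (n + 1).factorial) := by
          rw [integral_const_mul, integral_pow_abs_sub_uIoc, sub_zero, Nat.factorial_succ]
          push_cast
          field_simp
          ring

theorem summable_picardTerm [CompleteSpace V] (hA : Continuous A) (hK : ∀ t, ‖A t‖ ≤ K) (t : ℝ) :
    Summable fun n => picardTerm A x₀ n t :=
  .of_norm_bounded ((Real.summable_pow_div_factorial (K * |t|)).mul_left ‖x₀‖)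
    fun n => norm_picardTerm_le hA hK n t

/-- Differentiating term `n + 1` gives `A` applied to term `n`, so the series reproduces itself once
the constant term is split off. On `|s| < |t| + 1` the factorial bound supplies the uniform
majorant. -/
theorem hasDerivAt_tsum_picardTerm [CompleteSpace V] (hA : Continuous A) (hK : ∀ t, ‖A t‖ ≤ K)
    (t : ℝ) :
    HasDerivAt (fun s => ∑' n, picardTerm A x₀ n s) (A t (∑' n, picardTerm A x₀ n t)) t := by
  have hK0 : 0 ≤ K := (norm_nonneg _).trans (hK 0)
  have h := hasDerivAt_tsum_of_isPreconnected
    (u := fun n => K * (‖x₀‖ * ((K * (|t| + 1)) ^ n / n.factorial)))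
    (g := fun n => picardTerm A x₀ (n + 1)) (g' := fun n s => A s (picardTerm A x₀ n s))
    (t := Ioo (-(|t| + 1)) (|t| + 1)) (y₀ := t) (y := t)
    (((Real.summable_pow_div_factorial _).mul_left _).mul_left _) isOpen_Ioo isPreconnected_Ioo
    (fun n s _ => hasDerivAt_picardTerm_succ hA n s)
    (fun n s hs => (A s).le_of_opNorm_le_of_le (hK s)
      ((norm_picardTerm_le hA hK n s).trans (by
        have : |s| ≤ |t| + 1 := (abs_lt.2 hs).le
        gcongr)))
    (abs_lt.1 (lt_add_one _)) ((summable_nat_add_iff 1).2 (summable_picardTerm hA hK t))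
    (abs_lt.1 (lt_add_one _))
  have e : (fun s => ∑' n, picardTerm A x₀ n s) = fun s => x₀ + ∑' n, picardTerm A x₀ (n + 1) s :=
    funext fun s => (summable_picardTerm hA hK s).tsum_eq_zero_add
  rw [(A t).map_tsum (summable_picardTerm hA hK t), e]
  exact h.const_add x₀

theorem tsum_picardTerm_zero : ∑' n, picardTerm A x₀ n 0 = x₀ := by
  rw [tsum_eq_single 0]
  · rfl
  · intro n hn
    obtain ⟨m, rfl⟩ := Nat.exists_eq_succ_of_ne_zero hn
    simp [picardTerm]

/-- Uniqueness for linear equations: every solution on `[0,1]` is the sum of the Picard series. -/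
theorem eqOn_tsum_picardTerm [CompleteSpace V] (hA : Continuous A) (hK : ∀ t, ‖A t‖ ≤ K)
    {f : ℝ → V} (h0 : f 0 = x₀)
    (hf : ∀ t ∈ Icc (0 : ℝ) 1, HasDerivWithinAt f (A t (f t)) (Icc 0 1) t) :
    EqOn f (fun t => ∑' n, picardTerm A x₀ n t) (Icc 0 1) := by
  have hK0 : 0 ≤ K := (norm_nonneg _).trans (hK 0)
  refine ODE_solution_unique (v := fun t x => A t x) (K := K.toNNReal) (fun t => ?_)
    (fun t ht => (hf t ht).continuousWithinAt) (fun t ht => ?_)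
    (fun t _ => (hasDerivAt_tsum_picardTerm hA hK t).continuousAt.continuousWithinAt)
    (fun t _ => (hasDerivAt_tsum_picardTerm hA hK t).hasDerivWithinAt) ?_
  · refine (A t).lipschitz.weaken ?_
    rw [← NNReal.coe_le_coe, Real.coe_toNNReal _ hK0]
    exact hK t
  · exact (hf t (Ico_subset_Icc_self ht)).mono_of_mem_nhdsWithin (Icc_mem_nhdsGE_of_mem ht)
  · simp only [h0, tsum_picardTerm_zero]

end Picard

/-! ### The development at the base point, read off from the signature. -/

section Signature

variable {d : ℕ} {γ : ℝ → E d}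

theorem hypGen_mulVec_inl (x : E d) (z : Fin d ⊕ Unit → ℝ) (i : Fin d) :
    (hypGen x *ᵥ z) (Sum.inl i) = x i * z (Sum.inr ()) := by
  simp [hypGen, Matrix.mulVec, dotProduct]

theorem hypGen_mulVec_inr (x : E d) (z : Fin d ⊕ Unit → ℝ) (u : Unit) :
    (hypGen x *ᵥ z) (Sum.inr u) = ∑ i, x i * z (Sum.inl i) := by
  simp [hypGen, Matrix.mulVec, dotProduct]

/-- The operator `z ↦ F(l γ'(t)) z`, extended by constants outside `[0,1]`. -/
def hypField (γ : ℝ → E d) (l t : ℝ) : (Fin d ⊕ Unit → ℝ) →L[ℝ] (Fin d ⊕ Unit → ℝ) :=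
  LinearMap.toContinuousLinearMap
    (Matrix.mulVecLin (hypGen (l • velocity γ (projIcc 0 1 zero_le_one t))))

theorem hypField_apply (l t : ℝ) (z : Fin d ⊕ Unit → ℝ) :
    hypField γ l t z = hypGen (l • velocity γ (projIcc 0 1 zero_le_one t)) *ᵥ z := rfl

theorem hypField_apply_of_mem {t : ℝ} (ht : t ∈ Icc (0 : ℝ) 1) (l : ℝ) (z : Fin d ⊕ Unit → ℝ) :
    hypField γ l t z = hypGen (l • velocity γ t) *ᵥ z := by
  rw [hypField_apply, projIcc_of_mem _ ht]

theorem continuous_hypField (hγ : ContinuousOn (velocity γ) (Icc 0 1)) (l : ℝ) :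
    Continuous (hypField γ l) := by
  have hv : Continuous fun t : ℝ => velocity γ (projIcc 0 1 zero_le_one t) :=
    hγ.comp_continuous (continuous_subtype_val.comp continuous_projIcc) fun t =>
      (projIcc (0 : ℝ) 1 zero_le_one t).2
  refine continuous_clm_apply.2 fun z => continuous_pi fun a => ?_
  simp only [hypField_apply]
  rcases a with i | ⟨⟩
  · simp only [hypGen_mulVec_inl]
    fun_prop
  · simp only [hypGen_mulVec_inr]
    fun_prop

/-- The field factors through the projection onto the compact interval `[0,1]`, so a bound there is
global. -/
theorem exists_norm_hypField_le (hγ : ContinuousOn (velocity γ) (Icc 0 1)) (l : ℝ) :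
    ∃ K, ∀ t, ‖hypField γ l t‖ ≤ K := by
  obtain ⟨K, hK⟩ := isCompact_Icc.exists_bound_of_continuousOn (s := Icc (0 : ℝ) 1)
    (continuous_hypField hγ l).continuousOn
  refine ⟨K, fun t => ?_⟩
  have h := hK _ (projIcc (0 : ℝ) 1 zero_le_one t).2
  rwa [hypField, projIcc_of_mem _ (projIcc (0 : ℝ) 1 zero_le_one t).2] at h

theorem continuousOn_iterInt (hγ : ContinuousOn (velocity γ) (Icc 0 1)) (w : List (Fin d)) :
    ContinuousOn (iterInt γ w) (Icc 0 1) := by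
  induction w with
  | nil => exact continuousOn_const
  | cons i w ih =>
    have h : ContinuousOn (fun u => iterInt γ w u * velocity γ u i) (Icc 0 1) :=
      ih.mul ((EuclideanSpace.proj i).continuous.comp_continuousOn hγ)
    rw [← uIcc_of_le zero_le_one] at h ⊢
    exact intervalIntegral.continuousOn_primitive_interval
      (h.integrableOn_compact isCompact_uIcc)

theorem intervalIntegrable_iterInt (hγ : ContinuousOn (velocity γ) (Icc 0 1)) (w : List (Fin d))
    (i : Fin d) {t : ℝ} (ht : t ∈ Icc (0 : ℝ) 1) :
    IntervalIntegrable (fun u => iterInt γ w u * velocity γ u i) volume 0 t := by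
  refine ContinuousOn.intervalIntegrable ?_
  rw [uIcc_of_le ht.1]
  exact ((continuousOn_iterInt hγ w).mul
    ((EuclideanSpace.proj i).continuous.comp_continuousOn hγ)).mono (Icc_subset_Icc_right ht.2)

theorem doubledWord_snoc {n : ℕ} (i : Fin n → Fin d) (a : Fin d) :
    doubledWord (Fin.snoc i a : Fin (n + 1) → Fin d) = doubledWord i ++ [a, a] := by
  rw [doubledWord, List.ofFn_succ']
  simp [doubledWord]

theorem picardTerm_succ_apply (hγ : ContinuousOn (velocity γ) (Icc 0 1)) (l : ℝ)
    (x₀ : Fin d ⊕ Unit → ℝ) (n : ℕ) {t : ℝ} (ht : t ∈ Icc (0 : ℝ) 1) (a : Fin d ⊕ Unit) :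
    picardTerm (hypField γ l) x₀ (n + 1) t a =
      ∫ u in (0 : ℝ)..t, (hypGen (l • velocity γ u) *ᵥ picardTerm (hypField γ l) x₀ n u) a := by
  have hc := (continuous_hypField hγ l).clm_apply
    (continuous_picardTerm (x₀ := x₀) (continuous_hypField hγ l) n)
  have h := (ContinuousLinearMap.proj (R := ℝ) (φ := fun _ : Fin d ⊕ Unit => ℝ) a).intervalIntegral_comp_comm
    (hc.intervalIntegrable 0 t (μ := volume))
  refine h.symm.trans (intervalIntegral.integral_congr fun u hu => ?_)
  rw [uIcc_of_le ht.1] at hu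
  simp only [ContinuousLinearMap.proj_apply]
  rw [hypField_apply_of_mem ⟨hu.1, hu.2.trans ht.2⟩]

/-- The matrix `F(x)` exchanges the spatial and the last coordinates: a purely temporal term becomes
purely spatial, and its coordinate `a` acquires the new outermost letter `a`. -/
theorem picardTerm_odd_of_even (hγ : ContinuousOn (velocity γ) (Icc 0 1)) (l : ℝ) (n : ℕ)
    (h : ∀ t ∈ Icc (0 : ℝ) 1, picardTerm (hypField γ l) (basePoint d) (2 * n) t =
      Sum.elim (0 : Fin d → ℝ) fun _ =>
        l ^ (2 * n) * ∑ i : Fin n → Fin d, iterInt γ (doubledWord i).reverse t)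
    {t : ℝ} (ht : t ∈ Icc (0 : ℝ) 1) :
    picardTerm (hypField γ l) (basePoint d) (2 * n + 1) t =
      Sum.elim (fun a => l ^ (2 * n + 1) *
        ∑ i : Fin n → Fin d, iterInt γ (a :: (doubledWord i).reverse) t) (0 : Unit → ℝ) := by
  have hsub : ∀ u ∈ uIcc 0 t, u ∈ Icc (0 : ℝ) 1 := fun u hu => by
    rw [uIcc_of_le ht.1] at hu
    exact ⟨hu.1, hu.2.trans ht.2⟩
  funext a
  rw [picardTerm_succ_apply hγ l _ _ ht]
  rcases a with a | ⟨⟩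
  · simp only [hypGen_mulVec_inl, Sum.elim_inl, iterInt]
    rw [← intervalIntegral.integral_finsetSum
      fun i _ => intervalIntegrable_iterInt hγ _ a ht, ← intervalIntegral.integral_const_mul]
    refine intervalIntegral.integral_congr fun u hu => ?_
    simp only [h u (hsub u hu), Sum.elim_inr, PiLp.smul_apply, smul_eq_mul, ← Finset.sum_mul]
    ring
  · simp only [hypGen_mulVec_inr, Sum.elim_inr, Pi.zero_apply]
    rw [intervalIntegral.integral_congr (g := fun _ => (0 : ℝ)) fun u hu => ?_]
    · simp
    · simp [h u (hsub u hu)]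

/-- The next application of `F` pairs coordinate `a` with `dγ^{(a)}` and sums over `a`, which
doubles the letter just added. -/
theorem picardTerm_even_of_odd (hγ : ContinuousOn (velocity γ) (Icc 0 1)) (l : ℝ) (n : ℕ)
    (h : ∀ t ∈ Icc (0 : ℝ) 1, picardTerm (hypField γ l) (basePoint d) (2 * n + 1) t =
      Sum.elim (fun a => l ^ (2 * n + 1) *
        ∑ i : Fin n → Fin d, iterInt γ (a :: (doubledWord i).reverse) t) (0 : Unit → ℝ))
    {t : ℝ} (ht : t ∈ Icc (0 : ℝ) 1) :
    picardTerm (hypField γ l) (basePoint d) (2 * (n + 1)) t =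
      Sum.elim (0 : Fin d → ℝ) fun _ => l ^ (2 * (n + 1)) *
        ∑ i : Fin (n + 1) → Fin d, iterInt γ (doubledWord i).reverse t := by
  have hsub : ∀ u ∈ uIcc 0 t, u ∈ Icc (0 : ℝ) 1 := fun u hu => by
    rw [uIcc_of_le ht.1] at hu
    exact ⟨hu.1, hu.2.trans ht.2⟩
  funext a
  rw [mul_add, mul_one, picardTerm_succ_apply hγ l _ (2 * n + 1) ht]
  rcases a with a | ⟨⟩
  · simp only [hypGen_mulVec_inl, Sum.elim_inl, Pi.zero_apply]
    rw [intervalIntegral.integral_congr (g := fun _ => (0 : ℝ)) fun u hu => ?_]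
    · simp
    · simp [h u (hsub u hu)]
  -- The last letter is split off, since it carries the two outermost integrations.
  · rw [Sum.elim_inr, ← (Fin.snocEquiv fun _ => Fin d).sum_comp, Fintype.sum_prod_type]
    have e : ∀ (a : Fin d) (i : Fin n → Fin d),
        iterInt γ (doubledWord (Fin.snocEquiv (fun _ => Fin d) (a, i))).reverse t =
          ∫ u in (0 : ℝ)..t, iterInt γ (a :: (doubledWord i).reverse) u * velocity γ u a := by
      intro a i
      rw [show Fin.snocEquiv (fun _ => Fin d) (a, i) = (Fin.snoc i a : Fin (n + 1) → Fin d) from rfl,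
        doubledWord_snoc, List.reverse_append]
      simp [iterInt]
    simp only [e, hypGen_mulVec_inr]
    have e' : ∀ a : Fin d, ∑ i : Fin n → Fin d,
        (∫ u in (0 : ℝ)..t, iterInt γ (a :: (doubledWord i).reverse) u * velocity γ u a) =
        ∫ u in (0 : ℝ)..t, ∑ i : Fin n → Fin d,
          iterInt γ (a :: (doubledWord i).reverse) u * velocity γ u a := fun a =>
      (intervalIntegral.integral_finsetSum
        fun i _ => intervalIntegrable_iterInt hγ _ a ht).symm
    simp only [e']
    rw [← intervalIntegral.integral_finsetSum, ← intervalIntegral.integral_const_mul]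
    · refine intervalIntegral.integral_congr fun u hu => ?_
      simp only [h u (hsub u hu), Sum.elim_inl, PiLp.smul_apply, smul_eq_mul, ← Finset.sum_mul,
        Finset.mul_sum (a := l ^ (2 * n + 2))]
      exact Finset.sum_congr rfl fun a _ => by ring
    · intro a _
      have := IntervalIntegrable.sum Finset.univ fun (i : Fin n → Fin d) _ =>
        intervalIntegrable_iterInt hγ (a :: (doubledWord i).reverse) a ht
      simpa only [Finset.sum_fn] using this

theorem picardTerm_even (hγ : ContinuousOn (velocity γ) (Icc 0 1)) (l : ℝ) (n : ℕ) {t : ℝ}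
    (ht : t ∈ Icc (0 : ℝ) 1) :
    picardTerm (hypField γ l) (basePoint d) (2 * n) t =
      Sum.elim (0 : Fin d → ℝ) fun _ =>
        l ^ (2 * n) * ∑ i : Fin n → Fin d, iterInt γ (doubledWord i).reverse t := by
  induction n generalizing t with
  | zero =>
    funext a
    rcases a with a | ⟨⟩ <;> simp [picardTerm, basePoint, doubledWord, iterInt]
  | succ n ih =>
    exact picardTerm_even_of_odd hγ l n
      (fun t ht => picardTerm_odd_of_even hγ l n (fun t ht => ih ht) ht) ht

theorem endTerm_signature (hγ : ContinuousOn (velocity γ) (Icc 0 1)) (l : ℝ) (n : ℕ) :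
    endTerm (signature γ) l n = picardTerm (hypField γ l) (basePoint d) (2 * n) 1 +
      picardTerm (hypField γ l) (basePoint d) (2 * n + 1) 1 := by
  have h1 : (1 : ℝ) ∈ Icc (0 : ℝ) 1 := ⟨zero_le_one, le_rfl⟩
  rw [picardTerm_odd_of_even hγ l n (fun t ht => picardTerm_even hγ l n ht) h1,
    picardTerm_even hγ l n h1]
  funext a
  rcases a with a | ⟨⟩ <;> simp [endTerm, signature]

/-- The point `Γ(t) o`, where `Γ` is the Cartan development of `l γ`. -/
def hypPoint (γ : ℝ → E d) (l t : ℝ) : Fin d ⊕ Unit → ℝ :=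
  ∑' n, picardTerm (hypField γ l) (basePoint d) n t

theorem _root_.Summable.hasSum_even_add_odd {V : Type*} [NormedAddCommGroup V] [CompleteSpace V]
    {f : ℕ → V} (hf : Summable f) : HasSum (fun n => f (2 * n) + f (2 * n + 1)) (∑' n, f n) := by
  have he : Summable fun n => f (2 * n) := hf.comp_injective fun a b h => by simpa using h
  have ho : Summable fun n => f (2 * n + 1) :=
    hf.comp_injective (i := fun n => 2 * n + 1) fun a b h => by simpa using h
  rw [← tsum_even_add_odd he ho]
  exact he.hasSum.add ho.hasSum

/-- Each `endTerm` groups an even Picard term with the following odd one. Summability in a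
finite-dimensional space amounts to absolute convergence of the coordinate series. -/
theorem hasSum_endTerm (hγ : ContinuousOn (velocity γ) (Icc 0 1)) (l : ℝ) :
    HasSum (endTerm (signature γ) l) (hypPoint γ l 1) := by
  obtain ⟨K, hK⟩ := exists_norm_hypField_le hγ l
  rw [funext (endTerm_signature hγ l)]
  exact (summable_picardTerm (continuous_hypField hγ l) hK 1).hasSum_even_add_odd

theorem endPoint_signature (hγ : ContinuousOn (velocity γ) (Icc 0 1)) (l : ℝ) :
    endPoint (signature γ) l = hypPoint γ l 1 :=
  (hasSum_endTerm hγ l).tsum_eq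

theorem hasDerivWithinAt_hypPoint (hγ : ContinuousOn (velocity γ) (Icc 0 1)) (l : ℝ) {t : ℝ}
    (ht : t ∈ Icc (0 : ℝ) 1) :
    HasDerivWithinAt (hypPoint γ l) (hypGen (l • velocity γ t) *ᵥ hypPoint γ l t) (Icc 0 1) t := by
  obtain ⟨K, hK⟩ := exists_norm_hypField_le hγ l
  rw [← hypField_apply_of_mem ht]
  exact (hasDerivAt_tsum_picardTerm (continuous_hypField hγ l) hK t).hasDerivWithinAt

theorem hypPoint_zero (l : ℝ) : hypPoint γ l 0 = basePoint d := tsum_picardTerm_zero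

theorem velocity_const_smul (l t : ℝ) : velocity (fun s => l • γ s) t = l • velocity γ t :=
  derivWithin_fun_const_smul_field l γ

/-- The matrix equation decouples into its columns, each solved by a Picard series started at a unit
vector. -/
theorem exists_isCartanDevelopment (hγ : ContinuousOn (velocity γ) (Icc 0 1)) (l : ℝ) :
    ∃ Γ, IsCartanDevelopment (fun t => l • γ t) Γ := by
  obtain ⟨K, hK⟩ := exists_norm_hypField_le hγ l
  refine ⟨fun t => Matrix.of fun a b => (∑' n, picardTerm (hypField γ l) (Pi.single b 1) n t) a,
    ?_, fun t ht a b => ?_⟩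
  · ext a b
    rw [Matrix.of_apply, tsum_picardTerm_zero, Matrix.one_apply, Pi.single_apply]
  · have h := hasDerivWithinAt_pi.1 ((hasDerivAt_tsum_picardTerm (x₀ := Pi.single b 1)
      (continuous_hypField hγ l) hK t).hasDerivWithinAt (s := Icc 0 1)) a
    rw [hypField_apply_of_mem ht] at h
    rw [velocity_const_smul]
    exact h

theorem IsCartanDevelopment.mulVec_basePoint (hγ : ContinuousOn (velocity γ) (Icc 0 1)) {l : ℝ}
    {Γ : ℝ → Matrix (Fin d ⊕ Unit) (Fin d ⊕ Unit) ℝ}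
    (hΓ : IsCartanDevelopment (fun t => l • γ t) Γ) {t : ℝ} (ht : t ∈ Icc (0 : ℝ) 1) :
    Γ t *ᵥ basePoint d = hypPoint γ l t := by
  obtain ⟨K, hK⟩ := exists_norm_hypField_le hγ l
  refine eqOn_tsum_picardTerm (continuous_hypField hγ l) hK
    (f := fun t => Γ t *ᵥ basePoint d) (by simp [hΓ.init]) (fun t ht => ?_) ht
  rw [hypField_apply_of_mem ht, hasDerivWithinAt_pi]
  intro a
  rw [Matrix.mulVec_mulVec]
  rw [← velocity_const_smul]
  exact HasDerivWithinAt.fun_sum (u := Finset.univ) fun b _ => (hΓ.ode t ht a b).mul_const (basePoint d b)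

/-- The spatial part of `hypPoint`. -/
def hypSpace (γ : ℝ → E d) (l t : ℝ) : E d := WithLp.toLp 2 fun i => hypPoint γ l t (Sum.inl i)

/-- The last coordinate of `hypPoint`. -/
def hypTime (γ : ℝ → E d) (l t : ℝ) : ℝ := hypPoint γ l t (Sum.inr ())

theorem hypSpace_zero (l : ℝ) : hypSpace γ l 0 = 0 := by
  ext i
  simp [hypSpace, hypPoint_zero, basePoint]

theorem hypTime_zero (l : ℝ) : hypTime γ l 0 = 1 := by
  simp [hypTime, hypPoint_zero, basePoint]

theorem hasDerivWithinAt_hypSpace (hγ : ContinuousOn (velocity γ) (Icc 0 1)) (l : ℝ) {t : ℝ}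
    (ht : t ∈ Icc (0 : ℝ) 1) :
    HasDerivWithinAt (hypSpace γ l) (hypTime γ l t • l • velocity γ t) (Icc 0 1) t := by
  have h := hasDerivWithinAt_pi.1 (hasDerivWithinAt_hypPoint hγ l ht)
  have h' : HasDerivWithinAt (fun t i => hypPoint γ l t (Sum.inl i))
      (fun i => (hypTime γ l t • l • velocity γ t) i) (Icc 0 1) t := by
    refine hasDerivWithinAt_pi.2 fun i => ?_
    refine (h (Sum.inl i)).congr_deriv ?_
    rw [hypGen_mulVec_inl, hypTime, PiLp.smul_apply, PiLp.smul_apply, PiLp.smul_apply, smul_eq_mul, smul_eq_mul,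
      mul_comm]
  exact ((PiLp.continuousLinearEquiv 2 ℝ
    fun _ : Fin d => ℝ).symm.toContinuousLinearMap.hasFDerivAt.comp_hasDerivWithinAt t h')

theorem hasDerivWithinAt_hypTime (hγ : ContinuousOn (velocity γ) (Icc 0 1)) (l : ℝ) {t : ℝ}
    (ht : t ∈ Icc (0 : ℝ) 1) :
    HasDerivWithinAt (hypTime γ l) (inner ℝ (l • velocity γ t) (hypSpace γ l t)) (Icc 0 1) t := by
  refine (hasDerivWithinAt_pi.1 (hasDerivWithinAt_hypPoint hγ l ht) (Sum.inr ())).congr_deriv ?_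
  rw [hypGen_mulVec_inr, PiLp.inner_apply]
  exact Finset.sum_congr rfl fun i _ => by simp [hypSpace, mul_comm]

end Signature

/-! ### Monotonicity and Grönwall estimates on an interval. -/

section Comparison

variable {a b : ℝ} {φ φ' : ℝ → ℝ}

theorem antitoneOn_Icc_of_hasDerivWithinAt
    (h : ∀ t ∈ Icc a b, HasDerivWithinAt φ (φ' t) (Icc a b) t) (h' : ∀ t ∈ Icc a b, φ' t ≤ 0) :
    AntitoneOn φ (Icc a b) :=
  antitoneOn_of_hasDerivWithinAt_nonpos (convex_Icc a b)
    (fun t ht => (h t ht).continuousWithinAt)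
    (fun t ht => (h t (interior_subset ht)).mono interior_subset)
    (fun t ht => h' t (interior_subset ht))

theorem monotoneOn_Icc_of_hasDerivWithinAt
    (h : ∀ t ∈ Icc a b, HasDerivWithinAt φ (φ' t) (Icc a b) t) (h' : ∀ t ∈ Icc a b, 0 ≤ φ' t) :
    MonotoneOn φ (Icc a b) :=
  monotoneOn_of_hasDerivWithinAt_nonneg (convex_Icc a b)
    (fun t ht => (h t ht).continuousWithinAt)
    (fun t ht => (h t (interior_subset ht)).mono interior_subset)
    (fun t ht => h' t (interior_subset ht))

/-- Grönwall's inequality for damped equations. -/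
theorem le_of_hasDerivWithinAt_le_neg_mul {α β : ℝ} (hα : 0 < α) (hβ : 0 ≤ β)
    (h : ∀ t ∈ Icc a b, HasDerivWithinAt φ (φ' t) (Icc a b) t)
    (h' : ∀ t ∈ Icc a b, φ' t ≤ -α * φ t + β) {t : ℝ} (ht : t ∈ Icc a b) :
    φ t ≤ β / α + Real.exp (-α * (t - a)) * φ a := by
  -- Integrating factor, centred at the equilibrium `β / α`.
  have hanti : AntitoneOn (fun t => Real.exp (α * (t - a)) * (φ t - β / α)) (Icc a b) := by
    refine antitoneOn_Icc_of_hasDerivWithinAt (φ' := fun t =>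
      Real.exp (α * (t - a)) * (α * 1) * (φ t - β / α) + Real.exp (α * (t - a)) * φ' t)
      (fun t ht => ?_) fun t ht => ?_
    · exact ((((hasDerivAt_id t).sub_const a).const_mul α).exp.hasDerivWithinAt).mul
        ((h t ht).sub_const _)
    · have e : Real.exp (α * (t - a)) * (α * 1) * (φ t - β / α) + Real.exp (α * (t - a)) * φ' t =
          Real.exp (α * (t - a)) * (φ' t - (-α * φ t + β)) := by
        field_simp
        ring
      rw [e]
      exact mul_nonpos_of_nonneg_of_nonpos (Real.exp_pos _).le (sub_nonpos.2 (h' t ht))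
  have h1 := hanti (left_mem_Icc.2 (ht.1.trans ht.2)) ht ht.1
  simp only [sub_self, mul_zero, Real.exp_zero, one_mul] at h1
  have h2 : Real.exp (-α * (t - a)) * Real.exp (α * (t - a)) = 1 := by
    rw [← Real.exp_add]
    simp
  have h3 := mul_le_mul_of_nonneg_left h1 (Real.exp_pos (-α * (t - a))).le
  rw [← mul_assoc, h2, one_mul] at h3
  have h4 : 0 ≤ Real.exp (-α * (t - a)) * (β / α) := by positivity
  linarith

end Comparison

/-! ### Hyperbolic curves with large speed. -/

section Asymptotics

variable {F : Type*} [NormedAddCommGroup F] [InnerProductSpace ℝ F]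

/-- The equations `s' = μ c θ`, `c' = μ ⟨θ, s⟩` on `[0,1]` of a point `(s, c)` of the hyperboloid,
started at the base point. -/
structure IsHypCurve (θ : ℝ → F) (μ : ℝ) (s : ℝ → F) (c : ℝ → ℝ) : Prop where
  space_zero : s 0 = 0
  time_zero : c 0 = 1
  space_deriv : ∀ t ∈ Icc (0 : ℝ) 1, HasDerivWithinAt s ((μ * c t) • θ t) (Icc 0 1) t
  time_deriv : ∀ t ∈ Icc (0 : ℝ) 1, HasDerivWithinAt c (μ * inner ℝ (θ t) (s t)) (Icc 0 1) t

namespace IsHypCurve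

variable {θ θ' : ℝ → F} {μ K : ℝ} {s : ℝ → F} {c : ℝ → ℝ} {t : ℝ}

/-- The Lorentz form `c² - |s|²` is conserved. -/
theorem time_sq (h : IsHypCurve θ μ s c) (ht : t ∈ Icc (0 : ℝ) 1) : c t ^ 2 = 1 + ‖s t‖ ^ 2 := by
  have hd : ∀ t ∈ Icc (0 : ℝ) 1,
      HasDerivWithinAt (fun t => c t ^ 2 - ‖s t‖ ^ 2) 0 (Icc 0 1) t := fun t ht => by
    refine (((h.time_deriv t ht).pow 2).sub (h.space_deriv t ht).norm_sq).congr_deriv ?_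
    rw [inner_smul_right, real_inner_comm]
    push_cast
    ring
  have h0 : (0 : ℝ) ∈ Icc (0 : ℝ) 1 := ⟨le_rfl, zero_le_one⟩
  have h1 := antitoneOn_Icc_of_hasDerivWithinAt hd (fun _ _ => le_rfl) h0 ht ht.1
  have h2 := monotoneOn_Icc_of_hasDerivWithinAt hd (fun _ _ => le_rfl) h0 ht ht.1
  simp only [h.space_zero, h.time_zero, norm_zero] at h1 h2
  linarith

/-- Since `c² ≥ 1`, passing from the upper sheet to the lower one would force a zero of `c`. -/
theorem one_le_time (h : IsHypCurve θ μ s c) (ht : t ∈ Icc (0 : ℝ) 1) : 1 ≤ c t := by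
  have hsq : ∀ u ∈ Icc (0 : ℝ) 1, 1 ≤ c u ^ 2 := fun u hu => by
    rw [h.time_sq hu]
    linarith [sq_nonneg ‖s u‖]
  by_contra! hlt
  have hneg : c t ≤ 0 := by nlinarith [hsq t ht]
  have hc : ContinuousOn c (Icc 0 t) := fun u hu =>
    (h.time_deriv u ⟨hu.1, hu.2.trans ht.2⟩).continuousWithinAt.mono (Icc_subset_Icc_right ht.2)
  obtain ⟨u, hu, hu0⟩ := intermediate_value_Icc' ht.1 hc ⟨hneg, h.time_zero ▸ zero_le_one⟩
  have := hsq u ⟨hu.1, hu.2.trans ht.2⟩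
  norm_num [hu0] at this

theorem time_pos (h : IsHypCurve θ μ s c) (ht : t ∈ Icc (0 : ℝ) 1) : 0 < c t :=
  zero_lt_one.trans_le (h.one_le_time ht)

theorem norm_space_le (h : IsHypCurve θ μ s c) (ht : t ∈ Icc (0 : ℝ) 1) : ‖s t‖ ≤ c t :=
  le_of_sq_le_sq (by rw [h.time_sq ht]; linarith) (h.time_pos ht).le

theorem norm_ratio_le (h : IsHypCurve θ μ s c) (ht : t ∈ Icc (0 : ℝ) 1) :
    ‖(c t)⁻¹ • s t‖ ≤ 1 := by
  rw [norm_smul, norm_inv, Real.norm_of_nonneg (h.time_pos ht).le, inv_mul_le_iff₀ (h.time_pos ht),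
    mul_one]
  exact h.norm_space_le ht

/-- In the Klein model the development solves a Riccati equation. -/
theorem hasDerivWithinAt_ratio (h : IsHypCurve θ μ s c) (ht : t ∈ Icc (0 : ℝ) 1) :
    HasDerivWithinAt (fun t => (c t)⁻¹ • s t)
      (μ • (θ t - inner ℝ (θ t) ((c t)⁻¹ • s t) • (c t)⁻¹ • s t)) (Icc 0 1) t := by
  have hc := (h.time_pos ht).ne'
  refine (((h.time_deriv t ht).inv hc).smul (h.space_deriv t ht)).congr_deriv ?_
  rw [inner_smul_right, Pi.inv_apply]
  match_scalars <;> field_simp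

/-- The derivative of `⟨θ, s⟩` is `μ c + ⟨θ', s⟩ ≥ (μ - K) c ≥ 0`, and the initial value is `0`. -/
theorem inner_space_nonneg (h : IsHypCurve θ μ s c) (hθ : ∀ t ∈ Icc (0 : ℝ) 1, ‖θ t‖ = 1)
    (hθ' : ∀ t ∈ Icc (0 : ℝ) 1, HasDerivWithinAt θ (θ' t) (Icc 0 1) t)
    (hK : ∀ t ∈ Icc (0 : ℝ) 1, ‖θ' t‖ ≤ K) (hμ : K ≤ μ) (ht : t ∈ Icc (0 : ℝ) 1) :
    0 ≤ inner ℝ (θ t) (s t) := by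
  have hm := monotoneOn_Icc_of_hasDerivWithinAt
    (fun t ht => (hθ' t ht).inner ℝ (h.space_deriv t ht)) (fun t ht => ?_)
    ⟨le_rfl, zero_le_one⟩ ht ht.1
  · simpa [h.space_zero] using hm
  · rw [inner_smul_right, real_inner_self_eq_norm_sq, hθ t ht]
    have h1 := (abs_le.1 (abs_real_inner_le_norm (θ' t) (s t))).1
    have h2 : ‖θ' t‖ * ‖s t‖ ≤ K * c t :=
      mul_le_mul (hK t ht) (h.norm_space_le ht) (norm_nonneg _) ((norm_nonneg _).trans (hK t ht))
    nlinarith [h.time_pos ht]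

theorem inner_ratio_le_one (h : IsHypCurve θ μ s c) (hθ : ∀ t ∈ Icc (0 : ℝ) 1, ‖θ t‖ = 1)
    (ht : t ∈ Icc (0 : ℝ) 1) : inner ℝ (θ t) ((c t)⁻¹ • s t) ≤ 1 :=
  (real_inner_le_norm _ _).trans (by rw [hθ t ht, one_mul]; exact h.norm_ratio_le ht)

/-- With `p = ⟨θ, s / c⟩`, the Riccati equation gives `(1 - p)' ≤ -μ (1 - p)(1 + p) + K`. As `0 ≤ p
≤ 1`, the factor `1 + p` may be replaced by `1`, and Grönwall applies with initial value `1`. -/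
theorem one_sub_inner_ratio_le (h : IsHypCurve θ μ s c) (hθ : ∀ t ∈ Icc (0 : ℝ) 1, ‖θ t‖ = 1)
    (hθ' : ∀ t ∈ Icc (0 : ℝ) 1, HasDerivWithinAt θ (θ' t) (Icc 0 1) t)
    (hK : ∀ t ∈ Icc (0 : ℝ) 1, ‖θ' t‖ ≤ K) (hμ : K ≤ μ) (hμ0 : 0 < μ)
    (ht : t ∈ Icc (0 : ℝ) 1) :
    1 - inner ℝ (θ t) ((c t)⁻¹ • s t) ≤ K / μ + Real.exp (-μ * t) := by
  have h0 : (0 : ℝ) ∈ Icc (0 : ℝ) 1 := ⟨le_rfl, zero_le_one⟩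
  have hg := le_of_hasDerivWithinAt_le_neg_mul (φ := fun t => 1 - inner ℝ (θ t) ((c t)⁻¹ • s t)) hμ0
    ((norm_nonneg _).trans (hK 0 h0))
    (fun t ht => ((hθ' t ht).inner ℝ (h.hasDerivWithinAt_ratio ht)).const_sub 1)
    (fun t ht => ?_) ht
  · simpa [h.space_zero] using hg
  · have hp0 : 0 ≤ inner ℝ (θ t) ((c t)⁻¹ • s t) := by
      rw [inner_smul_right]
      exact mul_nonneg (inv_nonneg.2 (h.time_pos ht).le) (h.inner_space_nonneg hθ hθ' hK hμ ht)
    have hp1 := h.inner_ratio_le_one hθ ht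
    have h1 := (abs_le.1 (abs_real_inner_le_norm (θ' t) ((c t)⁻¹ • s t))).1
    have h2 : ‖θ' t‖ * ‖(c t)⁻¹ • s t‖ ≤ K * 1 :=
      mul_le_mul (hK t ht) (h.norm_ratio_le ht) (norm_nonneg _) ((norm_nonneg _).trans (hK t ht))
    rw [inner_smul_right _ _ μ, inner_sub_right, inner_smul_right _ _ (inner ℝ (θ t) _),
      real_inner_self_eq_norm_sq, hθ t ht]
    generalize inner ℝ (θ t) ((c t)⁻¹ • s t) = p at *
    nlinarith [mul_nonneg hμ0.le (mul_nonneg hp0 (sub_nonneg.2 hp1))]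

theorem hasDerivWithinAt_log_time (h : IsHypCurve θ μ s c) (ht : t ∈ Icc (0 : ℝ) 1) :
    HasDerivWithinAt (fun t => Real.log (c t)) (μ * inner ℝ (θ t) ((c t)⁻¹ • s t)) (Icc 0 1) t := by
  refine ((h.time_deriv t ht).log (h.time_pos ht).ne').congr_deriv ?_
  rw [inner_smul_right]
  ring

theorem log_time_one_le (h : IsHypCurve θ μ s c) (hθ : ∀ t ∈ Icc (0 : ℝ) 1, ‖θ t‖ = 1)
    (hμ0 : 0 ≤ μ) : Real.log (c 1) ≤ μ := by
  have hm := antitoneOn_Icc_of_hasDerivWithinAt (φ := fun t => Real.log (c t) - μ * t)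
    (fun t ht => (h.hasDerivWithinAt_log_time ht).sub
      ((hasDerivAt_id t).const_mul μ).hasDerivWithinAt)
    (fun t ht => ?_) ⟨le_rfl, zero_le_one⟩ ⟨zero_le_one, le_rfl⟩ zero_le_one
  · simpa [h.time_zero] using hm
  · nlinarith [h.inner_ratio_le_one hθ ht]

theorem le_log_time_one (h : IsHypCurve θ μ s c) (hθ : ∀ t ∈ Icc (0 : ℝ) 1, ‖θ t‖ = 1)
    (hθ' : ∀ t ∈ Icc (0 : ℝ) 1, HasDerivWithinAt θ (θ' t) (Icc 0 1) t)
    (hK : ∀ t ∈ Icc (0 : ℝ) 1, ‖θ' t‖ ≤ K) (hμ : K ≤ μ) (hμ0 : 0 < μ) :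
    μ - 1 - K ≤ Real.log (c 1) := by
  -- The added terms integrate the bound `μ (1 - p) ≤ K + μ exp (-μ t)`; the exponential contributes
  -- at most `1`.
  have hm := monotoneOn_Icc_of_hasDerivWithinAt
    (φ := fun t => Real.log (c t) + (K - μ) * t - Real.exp (-μ * t))
    (fun t ht => ((h.hasDerivWithinAt_log_time ht).add
      ((hasDerivAt_id t).const_mul (K - μ)).hasDerivWithinAt).sub
        (((hasDerivAt_id t).const_mul (-μ)).exp.hasDerivWithinAt))
    (fun t ht => ?_) ⟨le_rfl, zero_le_one⟩ ⟨zero_le_one, le_rfl⟩ zero_le_one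
  · simp only [h.time_zero, Real.log_one, mul_zero, Real.exp_zero, mul_one] at hm
    linarith [Real.exp_pos (-μ)]
  · have hq := h.one_sub_inner_ratio_le hθ hθ' hK hμ hμ0 ht
    have h1 := mul_le_mul_of_nonneg_left hq hμ0.le
    rw [mul_add, mul_div_cancel₀ _ hμ0.ne'] at h1
    simp only [id, mul_one]
    linarith

end IsHypCurve

theorem eventually_nhdsWithin_Icc_one {P : ℝ → Prop} (h : ∀ᶠ t in 𝓝[Icc (0 : ℝ) 1] 1, P t) :
    ∃ τ ∈ Ico (0 : ℝ) 1, ∀ t ∈ Icc τ 1, P t := by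
  rw [nhdsWithin_Icc_eq_nhdsLE zero_lt_one] at h
  obtain ⟨l, hl, hP⟩ := (mem_nhdsLE_iff_exists_Icc_subset).1 h
  exact ⟨max l 0, ⟨le_max_right _ _, max_lt hl zero_lt_one⟩,
    fun t ht => hP ⟨(le_max_left _ _).trans ht.1, ht.2⟩⟩

theorem Icc_mem_nhdsWithin_Icc_one {τ : ℝ} (hτ : τ < 1) : Icc τ 1 ∈ 𝓝[Icc (0 : ℝ) 1] 1 := by
  rw [nhdsWithin_Icc_eq_nhdsLE zero_lt_one]
  exact Icc_mem_nhdsLE hτ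

/-- A damped equation with small forcing near `t = 1` forgets its initial layer. -/
theorem tendsto_zero_of_damped {θ : ℝ → F} {p : ℝ → ℝ → ℝ} {g u : ℝ → ℝ → F} {C : ℝ} {N : ℕ}
    (hu : ∀ μ, 0 < μ → ∀ t ∈ Icc (0 : ℝ) 1, HasDerivWithinAt (u μ)
      (-μ • (inner ℝ (θ t) (u μ t) • θ t + p μ t • u μ t - g μ t)) (Icc 0 1) t)
    (hp : Tendsto (fun x : ℝ × ℝ => p x.1 x.2) (atTop ×ˢ 𝓝[Icc (0 : ℝ) 1] 1) (𝓝 1))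
    (hg : Tendsto (fun x : ℝ × ℝ => g x.1 x.2) (atTop ×ˢ 𝓝[Icc (0 : ℝ) 1] 1) (𝓝 0))
    (hC : ∀ μ, 1 ≤ μ → ∀ t ∈ Icc (0 : ℝ) 1, ‖u μ t‖ ≤ C * μ ^ N) :
    Tendsto (fun x : ℝ × ℝ => u x.1 x.2) (atTop ×ˢ 𝓝[Icc (0 : ℝ) 1] 1) (𝓝 0) := by
  rw [Metric.tendsto_nhds]
  intro ε hε
  obtain ⟨pa, hpa, pb, hpb, hP⟩ := eventually_prod_iff.1
    ((hp.eventually_const_lt (show (1 / 2 : ℝ) < 1 by norm_num)).and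
      (Metric.tendsto_nhds.1 hg (ε / 3) (by positivity)))
  obtain ⟨τ, ⟨hτ0, hτ1⟩, hτ⟩ := eventually_nhdsWithin_Icc_one hpb
  -- The initial layer at `τ`, damped at rate `μ / 2` up to some `t ≥ (1 + τ) / 2`, that is, over a
  -- time at least `(1 - τ) / 2`.
  have hlim : Tendsto (fun μ : ℝ => C ^ 2 * (μ ^ (2 * N) / Real.exp ((1 - τ) / 4 * μ))) atTop
      (𝓝 0) := by
    have := ((isLittleO_pow_exp_pos_mul_atTop (k := 2 * N)
      (show 0 < (1 - τ) / 4 by linarith)).tendsto_div_nhds_zero).const_mul (C ^ 2)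
    rwa [mul_zero] at this
  refine eventually_prod_iff.2 ⟨_, (hpa.and (eventually_ge_atTop 1)).and
    (hlim.eventually_lt_const (show 0 < (ε / 3) ^ 2 by positivity)), _,
    Icc_mem_nhdsWithin_Icc_one (show (1 + τ) / 2 < 1 by linarith), ?_⟩
  rintro μ ⟨⟨hμa, hμ1⟩, hμe⟩ t ht
  have hμ0 : 0 < μ := zero_lt_one.trans_le hμ1
  have hsub : Icc τ 1 ⊆ Icc (0 : ℝ) 1 := Icc_subset_Icc_left hτ0
  have htτ : t ∈ Icc τ 1 := ⟨by linarith [ht.1], ht.2⟩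
  -- The choice of `α` and `β` leaves `4 (ε/3)²` from the forcing and less than `(ε/3)²` from the
  -- layer, in total below `ε²`.
  have key := le_of_hasDerivWithinAt_le_neg_mul (a := τ) (b := 1) (φ := fun t => ‖u μ t‖ ^ 2)
    (α := μ / 2) (β := 2 * μ * (ε / 3) ^ 2) (by positivity) (by positivity)
    (fun t ht => ((hu μ hμ0 t (hsub ht)).mono hsub).norm_sq) (fun t ht => ?_) htτ
  · have h1 : ‖u μ τ‖ ^ 2 ≤ C ^ 2 * μ ^ (2 * N) := by
      have := pow_le_pow_left₀ (norm_nonneg _) (hC μ hμ1 τ ⟨hτ0, hτ1.le⟩) 2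
      rwa [mul_pow, ← pow_mul, mul_comm N] at this
    have h2 : Real.exp (-(μ / 2) * (t - τ)) ≤ (Real.exp ((1 - τ) / 4 * μ))⁻¹ := by
      rw [← Real.exp_neg]
      refine Real.exp_le_exp.2 ?_
      nlinarith [ht.1]
    have h3 : Real.exp (-(μ / 2) * (t - τ)) * ‖u μ τ‖ ^ 2 < (ε / 3) ^ 2 :=
      (mul_le_mul h2 h1 (by positivity) (by positivity)).trans_lt
        (lt_of_eq_of_lt (by ring) hμe)
    have h4 : 2 * μ * (ε / 3) ^ 2 / (μ / 2) = 4 * (ε / 3) ^ 2 := by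
      field_simp
      norm_num
    rw [dist_zero_right]
    refine lt_of_pow_lt_pow_left₀ 2 hε.le ?_
    simp only [h4] at key
    nlinarith
  · obtain ⟨hp', hg'⟩ := hP hμa (hτ t ht)
    rw [dist_zero_right] at hg'
    rw [inner_smul_right, inner_sub_right, inner_add_right, inner_smul_right, inner_smul_right,
      real_inner_self_eq_norm_sq, real_inner_comm (u μ t) (θ t)]
    have h1 : inner ℝ (u μ t) (g μ t) ≤ ‖u μ t‖ * (ε / 3) :=
      (real_inner_le_norm _ _).trans (by gcongr)
    have h2 : 0 ≤ (p μ t - 1 / 2) * ‖u μ t‖ ^ 2 := mul_nonneg (by linarith) (sq_nonneg _)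
    -- Young's inequality: half of the damping guaranteed by `p > 1/2` absorbs the forcing.
    have h3 : inner ℝ (u μ t) (g μ t) ≤ ‖u μ t‖ ^ 2 / 4 + (ε / 3) ^ 2 := by
      nlinarith [sq_nonneg (‖u μ t‖ / 2 - ε / 3)]
    have h4 : 0 ≤ inner ℝ (u μ t) (θ t) * inner ℝ (u μ t) (θ t) := mul_self_nonneg _
    have h5 : 0 ≤ inner ℝ (u μ t) (θ t) * inner ℝ (u μ t) (θ t) + p μ t * ‖u μ t‖ ^ 2 -
        inner ℝ (u μ t) (g μ t) - (‖u μ t‖ ^ 2 / 4 - (ε / 3) ^ 2) := by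
      linarith
    nlinarith [mul_nonneg hμ0.le h5]

/-- A damped equation whose forcing converges near `t = 1` converges to the equilibrium. -/
theorem tendsto_of_damped {θ : ℝ → F} {p : ℝ → ℝ → ℝ} {f z : ℝ → ℝ → F} {a : F} {C : ℝ} {N : ℕ}
    (hz : ∀ μ, 0 < μ → ∀ t ∈ Icc (0 : ℝ) 1, HasDerivWithinAt (z μ)
      (-μ • (inner ℝ (θ t) (z μ t) • θ t + p μ t • z μ t - f μ t)) (Icc 0 1) t)
    (hθ : ContinuousWithinAt θ (Icc 0 1) 1)
    (hp : Tendsto (fun x : ℝ × ℝ => p x.1 x.2) (atTop ×ˢ 𝓝[Icc (0 : ℝ) 1] 1) (𝓝 1))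
    (hf : Tendsto (fun x : ℝ × ℝ => f x.1 x.2) (atTop ×ˢ 𝓝[Icc (0 : ℝ) 1] 1)
      (𝓝 (inner ℝ (θ 1) a • θ 1 + a)))
    (hC : ∀ μ, 1 ≤ μ → ∀ t ∈ Icc (0 : ℝ) 1, ‖z μ t‖ ≤ C * μ ^ N) :
    Tendsto (fun x : ℝ × ℝ => z x.1 x.2) (atTop ×ˢ 𝓝[Icc (0 : ℝ) 1] 1) (𝓝 a) := by
  have hθ' : Tendsto (fun x : ℝ × ℝ => θ x.2) (atTop ×ˢ 𝓝[Icc (0 : ℝ) 1] 1) (𝓝 (θ 1)) :=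
    hθ.tendsto.comp tendsto_snd
  have hg : Tendsto (fun x : ℝ × ℝ => f x.1 x.2 - inner ℝ (θ x.2) a • θ x.2 - p x.1 x.2 • a)
      (atTop ×ˢ 𝓝[Icc (0 : ℝ) 1] 1) (𝓝 0) := by
    have := (hf.sub ((hθ'.inner (𝕜 := ℝ) (tendsto_const_nhds (x := a))).smul hθ')).sub
      (hp.smul (tendsto_const_nhds (x := a)))
    simpa using this
  -- As `a` is constant, `z - a` solves the same damped equation, and the equilibrium condition
  -- makes its forcing vanish in the limit.
  have h0 := tendsto_zero_of_damped (θ := θ) (u := fun μ t => z μ t - a) (C := C + ‖a‖) (N := N)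
    (g := fun μ t => f μ t - inner ℝ (θ t) a • θ t - p μ t • a)
    (fun μ hμ t ht => ((hz μ hμ t ht).sub_const a).congr_deriv ?_) hp hg (fun μ hμ t ht => ?_)
  · simpa using h0.add_const a
  · rw [inner_sub_right]
    module
  · calc ‖z μ t - a‖ ≤ C * μ ^ N + ‖a‖ * 1 :=
        (norm_sub_le _ _).trans (by rw [mul_one]; exact add_le_add_left (hC μ hμ t ht) _)
      _ ≤ (C + ‖a‖) * μ ^ N := by
        rw [add_mul]
        gcongr
        exact one_le_pow₀ hμ

/-! ### Asymptotic expansion in powers of `1 / μ`. -/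

/-- Formal solutions `∑ Aₙ μ⁻ⁿ` of the Riccati equation, up to order `k`. -/
structure IsRiccatiExpansion (A A' : ℕ → ℝ → F) (k : ℕ) : Prop where
  norm_zero : ∀ t ∈ Icc (0 : ℝ) 1, ‖A 0 t‖ = 1
  continuousOn : ∀ n ≤ k, ContinuousOn (A n) (Icc 0 1)
  hasDeriv : ∀ n < k, ∀ t ∈ Icc (0 : ℝ) 1, HasDerivWithinAt (A n) (A' n t) (Icc 0 1) t
  recursion : ∀ n < k, ∀ t ∈ Icc (0 : ℝ) 1,
    A' n t + ∑ i ∈ Finset.range (n + 2), inner ℝ (A 0 t) (A (n + 1 - i) t) • A i t = 0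

/-- The rescaled remainders `μⁿ (y - ∑_{j < n} Aⱼ μ⁻ʲ)`. -/
def expansionRem (A : ℕ → ℝ → F) (y : ℝ → F) (μ : ℝ) : ℕ → ℝ → F
  | 0, t => y t
  | n + 1, t => μ • (expansionRem A y μ n t - A n t)

theorem expansionRem_eq (A : ℕ → ℝ → F) (y : ℝ → F) {μ : ℝ} (hμ : μ ≠ 0) (n : ℕ) (t : ℝ) :
    expansionRem A y μ n t =
      μ ^ n • (y t - ∑ j ∈ Finset.range n, (μ ^ j)⁻¹ • A j t) := by
  induction n with
  | zero => simp [expansionRem]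
  | succ n ih =>
    rw [expansionRem, ih, Finset.sum_range_succ, pow_succ', mul_smul, ← sub_sub, smul_sub (μ ^ n) (_ - _),
      smul_smul (μ ^ n), mul_inv_cancel₀ (pow_ne_zero n hμ), one_smul]

namespace IsRiccatiExpansion

variable {A A' : ℕ → ℝ → F} {k : ℕ}

/-- The recursion expresses `Aₙ'` algebraically through continuous coefficients. -/
theorem continuousOn_deriv (h : IsRiccatiExpansion A A' k) {n : ℕ} (hn : n < k) :
    ContinuousOn (A' n) (Icc 0 1) := by
  have hs : ContinuousOn (fun t => -∑ i ∈ Finset.range (n + 2),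
      inner ℝ (A 0 t) (A (n + 1 - i) t) • A i t) (Icc 0 1) := by
    refine (continuousOn_finsetSum _ fun i hi => ?_).neg
    have := Finset.mem_range.1 hi
    exact ((h.continuousOn 0 (by omega)).inner (𝕜 := ℝ) (h.continuousOn _ (by omega))).smul
      (h.continuousOn _ (by omega))
  exact hs.congr fun t ht => eq_neg_of_add_eq_zero_left (h.recursion n hn t ht)

/-- The remainder of order `n + 1` is damped through the summand `i = 0` and the last term, whose
factor `⟨A₀, s / c⟩` tends to `1`. Everything else is forcing by remainders of lower order. -/
theorem hasDerivWithinAt_rem (h : IsRiccatiExpansion A A' k) {s : ℝ → F} {c : ℝ → ℝ} {μ : ℝ}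
    (hsc : IsHypCurve (A 0) μ s c) {n : ℕ} (hn : n < k) {t : ℝ} (ht : t ∈ Icc (0 : ℝ) 1) :
    HasDerivWithinAt (expansionRem A (fun t => (c t)⁻¹ • s t) μ (n + 1))
      (-μ • (A' n t + ∑ i ∈ Finset.range (n + 1),
        inner ℝ (A 0 t) (expansionRem A (fun t => (c t)⁻¹ • s t) μ (n + 1 - i) t) • A i t +
        inner ℝ (A 0 t) ((c t)⁻¹ • s t) •
          expansionRem A (fun t => (c t)⁻¹ • s t) μ (n + 1) t)) (Icc 0 1) t := by
  have hone : inner ℝ (A 0 t) (A 0 t) = 1 := by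
    rw [real_inner_self_eq_norm_sq, h.norm_zero t ht, one_pow]
  induction n with
  | zero =>
    refine (((hsc.hasDerivWithinAt_ratio ht).sub (h.hasDeriv 0 hn t ht)).const_smul
      μ).congr_deriv ?_
    simp only [zero_add, Finset.sum_range_one, Nat.sub_zero, expansionRem]
    rw [inner_smul_right _ _ μ, inner_sub_right, hone]
    module
  | succ n ih =>
    refine (((ih (by omega)).sub (h.hasDeriv (n + 1) hn t ht)).const_smul μ).congr_deriv ?_
    have hr := eq_neg_of_add_eq_zero_left (h.recursion n (by omega) t ht)
    rw [Finset.sum_range_succ, Nat.sub_self, hone] at hr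
    rw [Finset.sum_range_succ _ (n + 1), Nat.add_sub_cancel_left, hr]
    -- Unfolding each remainder by one order leaves products of coefficients, which cancel against
    -- the recursion for `A_{n+1}`.
    have e : ∀ i ∈ Finset.range (n + 1),
        inner ℝ (A 0 t) (expansionRem A (fun t => (c t)⁻¹ • s t) μ (n + 1 + 1 - i) t) • A i t =
          μ • (inner ℝ (A 0 t) (expansionRem A (fun t => (c t)⁻¹ • s t) μ (n + 1 - i) t) • A i t) -
          μ • (inner ℝ (A 0 t) (A (n + 1 - i) t) • A i t) := fun i hi => by
      have := Finset.mem_range.1 hi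
      rw [show n + 1 + 1 - i = n + 1 - i + 1 by omega, expansionRem, inner_smul_right,
        inner_sub_right]
      module
    rw [Finset.sum_congr rfl e, Finset.sum_sub_distrib, ← Finset.smul_sum, ← Finset.smul_sum]
    generalize ∑ i ∈ Finset.range (n + 1), inner ℝ (A 0 t)
      (expansionRem A (fun t => (c t)⁻¹ • s t) μ (n + 1 - i) t) • A i t = S
    generalize ∑ i ∈ Finset.range (n + 1), inner ℝ (A 0 t) (A (n + 1 - i) t) • A i t = T
    rw [show expansionRem A (fun t => (c t)⁻¹ • s t) μ 1 t = μ • ((c t)⁻¹ • s t - A 0 t) from rfl,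
      show expansionRem A (fun t => (c t)⁻¹ • s t) μ (n + 1 + 1) t =
        μ • (expansionRem A (fun t => (c t)⁻¹ • s t) μ (n + 1) t - A (n + 1) t) from rfl,
      inner_smul_right _ _ μ, inner_sub_right, hone]
    module

/-- A crude bound suffices: it only has to lose against the exponential damping of the initial
layer. -/
theorem exists_norm_rem_le (h : IsRiccatiExpansion A A' k) {s : ℝ → ℝ → F} {c : ℝ → ℝ → ℝ}
    (hsc : ∀ μ, 0 < μ → IsHypCurve (A 0) μ (s μ) (c μ)) {n : ℕ} (hn : n ≤ k) :
    ∃ C, ∀ μ, 1 ≤ μ → ∀ t ∈ Icc (0 : ℝ) 1,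
      ‖expansionRem A (fun t => (c μ t)⁻¹ • s μ t) μ n t‖ ≤ C * μ ^ n := by
  induction n with
  | zero =>
    refine ⟨1, fun μ hμ t ht => ?_⟩
    rw [pow_zero, mul_one]
    exact (hsc μ (by linarith)).norm_ratio_le ht
  | succ n ih =>
    obtain ⟨C, hC⟩ := ih (by omega)
    obtain ⟨M, hM⟩ := isCompact_Icc.exists_bound_of_continuousOn (h.continuousOn n (by omega))
    refine ⟨C + M, fun μ hμ t ht => ?_⟩
    have hM0 : 0 ≤ M := (norm_nonneg _).trans (hM t ht)
    rw [expansionRem, norm_smul, Real.norm_of_nonneg (by linarith), pow_succ']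
    calc μ * ‖expansionRem A (fun t => (c μ t)⁻¹ • s μ t) μ n t - A n t‖
        ≤ μ * (C * μ ^ n + M * 1) := by
          refine mul_le_mul_of_nonneg_left ((norm_sub_le _ _).trans ?_) (by linarith)
          rw [mul_one]
          exact add_le_add (hC μ hμ t ht) (hM t ht)
      _ ≤ μ * (C * μ ^ n + M * μ ^ n) := by
          gcongr
          exact one_le_pow₀ hμ
      _ = (C + M) * (μ * μ ^ n) := by ring

theorem exists_norm_deriv_zero_le (h : IsRiccatiExpansion A A' k) (hk : 0 < k) :
    ∃ K, ∀ t ∈ Icc (0 : ℝ) 1, ‖A' 0 t‖ ≤ K :=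
  isCompact_Icc.exists_bound_of_continuousOn (h.continuousOn_deriv hk)

/-- As `|y| ≤ 1 = |θ|`, one has `|y - θ|² ≤ 2 (1 - ⟨θ, y⟩)`, which is small uniformly for `t ≥ 1/2`.
-/
theorem tendsto_ratio (h : IsRiccatiExpansion A A' k) (hk : 0 < k) {s : ℝ → ℝ → F}
    {c : ℝ → ℝ → ℝ} (hsc : ∀ μ, 0 < μ → IsHypCurve (A 0) μ (s μ) (c μ)) :
    Tendsto (fun x : ℝ × ℝ => (c x.1 x.2)⁻¹ • s x.1 x.2) (atTop ×ˢ 𝓝[Icc (0 : ℝ) 1] 1)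
      (𝓝 (A 0 1)) := by
  obtain ⟨K, hK⟩ := h.exists_norm_deriv_zero_le hk
  have hA : Tendsto (fun x : ℝ × ℝ => A 0 x.2) (atTop ×ˢ 𝓝[Icc (0 : ℝ) 1] 1) (𝓝 (A 0 1)) :=
    (h.continuousOn 0 hk.le 1 ⟨zero_le_one, le_rfl⟩).tendsto.comp tendsto_snd
  have hb : Tendsto (fun x : ℝ × ℝ => √(2 * (K / x.1 + Real.exp (-(1 / 2 * x.1)))))
      (atTop ×ˢ 𝓝[Icc (0 : ℝ) 1] 1) (𝓝 0) := by
    have h1 : Tendsto (fun μ : ℝ => √(2 * (K / μ + Real.exp (-(1 / 2 * μ))))) atTop (𝓝 0) := by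
      have := (((tendsto_const_nhds (x := K)).div_atTop tendsto_id).add
        (Real.tendsto_exp_neg_atTop_nhds_zero.comp
          (tendsto_id.const_mul_atTop (show (0 : ℝ) < 1 / 2 by norm_num)))).const_mul 2 |>.sqrt
      simpa using this
    exact h1.comp tendsto_fst
  have hd : Tendsto (fun x : ℝ × ℝ => (c x.1 x.2)⁻¹ • s x.1 x.2 - A 0 x.2)
      (atTop ×ˢ 𝓝[Icc (0 : ℝ) 1] 1) (𝓝 0) := by
    refine squeeze_zero_norm' (eventually_prod_iff.2 ⟨_, eventually_ge_atTop (max K 1), _,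
      Icc_mem_nhdsWithin_Icc_one (show (1 / 2 : ℝ) < 1 by norm_num), ?_⟩) hb
    intro μ hμ t ht
    have hμ0 : 0 < μ := by linarith [le_max_right K 1]
    have ht' : t ∈ Icc (0 : ℝ) 1 := ⟨by linarith [ht.1], ht.2⟩
    have hq := (hsc μ hμ0).one_sub_inner_ratio_le h.norm_zero (h.hasDeriv 0 hk) hK
      ((le_max_left _ _).trans hμ) hμ0 ht'
    have hn := (hsc μ hμ0).norm_ratio_le ht'
    have he : Real.exp (-μ * t) ≤ Real.exp (-(1 / 2 * μ)) :=
      Real.exp_le_exp.2 (by nlinarith [ht.1])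
    refine Real.le_sqrt_of_sq_le ?_
    simp only
    rw [norm_sub_sq_real, h.norm_zero t ht', real_inner_comm]
    nlinarith [norm_nonneg ((c μ t)⁻¹ • s μ t)]
  simpa using hd.add hA

/-- The limit is joint in `μ → ∞` and `t → 1` because the lower remainders enter the next forcing on
a whole neighbourhood of `1`. The recursion identifies the equilibrium as `A_{n+1}(1)`. -/
theorem tendsto_rem (h : IsRiccatiExpansion A A' k) (hk : 0 < k) {s : ℝ → ℝ → F}
    {c : ℝ → ℝ → ℝ} (hsc : ∀ μ, 0 < μ → IsHypCurve (A 0) μ (s μ) (c μ)) {n : ℕ} (hn : n ≤ k) :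
    Tendsto (fun x : ℝ × ℝ => expansionRem A (fun t => (c x.1 t)⁻¹ • s x.1 t) x.1 n x.2)
      (atTop ×ˢ 𝓝[Icc (0 : ℝ) 1] 1) (𝓝 (A n 1)) := by
  induction n using Nat.strong_induction_on with
  | _ n ih =>
    have h1 : (1 : ℝ) ∈ Icc (0 : ℝ) 1 := ⟨zero_le_one, le_rfl⟩
    have hlim : ∀ {G : ℝ → F}, ContinuousOn G (Icc 0 1) →
        Tendsto (fun x : ℝ × ℝ => G x.2) (atTop ×ˢ 𝓝[Icc (0 : ℝ) 1] 1) (𝓝 (G 1)) :=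
      fun hG => (hG 1 h1).tendsto.comp tendsto_snd
    have hone : inner ℝ (A 0 1) (A 0 1) = 1 := by
      rw [real_inner_self_eq_norm_sq, h.norm_zero 1 h1, one_pow]
    rcases n with _ | n
    · exact h.tendsto_ratio hk hsc
    obtain ⟨C, hC⟩ := h.exists_norm_rem_le hsc hn
    have hA0 := hlim (h.continuousOn 0 hk.le)
    refine tendsto_of_damped (θ := A 0)
      (z := fun μ => expansionRem A (fun t => (c μ t)⁻¹ • s μ t) μ (n + 1))
      (p := fun μ t => inner ℝ (A 0 t) ((c μ t)⁻¹ • s μ t))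
      (f := fun μ t => -(A' n t + ∑ i ∈ Finset.range n, inner ℝ (A 0 t)
        (expansionRem A (fun t => (c μ t)⁻¹ • s μ t) μ (n - i) t) • A (i + 1) t))
      (fun μ hμ t ht => (h.hasDerivWithinAt_rem (hsc μ hμ) hn ht).congr_deriv ?_)
      (h.continuousOn 0 hk.le 1 h1) ?_ ?_ hC
    -- The summand `i = 0` is the part `⟨θ, z⟩ θ` of the damping.
    · rw [Finset.sum_range_succ']
      simp only [Nat.add_sub_add_right, Nat.sub_zero]
      module
    · have := hA0.inner (𝕜 := ℝ) (h.tendsto_ratio hk hsc)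
      rwa [hone] at this
    · have hr := h.recursion n hn 1 h1
      rw [Finset.sum_range_succ, Finset.sum_range_succ', Nat.sub_self, hone] at hr
      simp only [Nat.add_sub_add_right, Nat.sub_zero, one_smul] at hr
      have e : inner ℝ (A 0 1) (A (n + 1) 1) • A 0 1 + A (n + 1) 1 =
          -(A' n 1 + ∑ i ∈ Finset.range n, inner ℝ (A 0 1) (A (n - i) 1) • A (i + 1) 1) := by
        rw [← sub_eq_zero, ← hr]
        abel
      rw [e]
      refine ((hlim (h.continuousOn_deriv hn)).add (tendsto_finsetSum _ fun i hi => ?_)).neg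
      have := Finset.mem_range.1 hi
      exact (hA0.inner (𝕜 := ℝ) (ih (n - i) (by omega) (by omega))).smul
        (hlim (h.continuousOn (i + 1) (by omega)))

theorem tendsto_rem_one (h : IsRiccatiExpansion A A' k) (hk : 0 < k) {s : ℝ → ℝ → F}
    {c : ℝ → ℝ → ℝ} (hsc : ∀ μ, 0 < μ → IsHypCurve (A 0) μ (s μ) (c μ)) {n : ℕ} (hn : n ≤ k) :
    Tendsto (fun μ : ℝ => μ ^ n • ((c μ 1)⁻¹ • s μ 1 -
      ∑ j ∈ Finset.range n, (μ ^ j)⁻¹ • A j 1)) atTop (𝓝 (A n 1)) := by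
  have h1 := (h.tendsto_rem hk hsc hn).comp (tendsto_id.prodMk (tendsto_const_nhdsWithin
    (show (1 : ℝ) ∈ Icc (0 : ℝ) 1 from ⟨zero_le_one, le_rfl⟩)))
  refine h1.congr' ?_
  filter_upwards [eventually_ne_atTop 0] with μ hμ
  exact expansionRem_eq A _ hμ n 1

/-- The direction of `s` has the same asymptotic expansion as `s / c`. -/
theorem tendsto_direction (h : IsRiccatiExpansion A A' k) (hk : 0 < k) {s : ℝ → ℝ → F}
    {c : ℝ → ℝ → ℝ} (hsc : ∀ μ, 0 < μ → IsHypCurve (A 0) μ (s μ) (c μ)) {n : ℕ} (hn : n ≤ k) :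
    Tendsto (fun μ : ℝ => μ ^ n • (‖s μ 1‖⁻¹ • s μ 1 -
      ∑ j ∈ Finset.range n, (μ ^ j)⁻¹ • A j 1)) atTop (𝓝 (A n 1)) := by
  obtain ⟨K, hK⟩ := h.exists_norm_deriv_zero_le hk
  have h1 : (1 : ℝ) ∈ Icc (0 : ℝ) 1 := ⟨zero_le_one, le_rfl⟩
  have hd : Tendsto (fun μ : ℝ => μ ^ n • (‖s μ 1‖⁻¹ • s μ 1 - (c μ 1)⁻¹ • s μ 1)) atTop
      (𝓝 0) := by
    have hb : Tendsto (fun μ : ℝ => Real.exp (1 + K) * (μ ^ n / Real.exp (1 * μ))) atTop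
        (𝓝 0) := by
      have := ((isLittleO_pow_exp_pos_mul_atTop (k := n)
        zero_lt_one).tendsto_div_nhds_zero).const_mul (Real.exp (1 + K))
      rwa [mul_zero] at this
    refine squeeze_zero_norm' ?_ hb
    filter_upwards [eventually_ge_atTop (max K 1)] with μ hμ
    have hμ0 : 0 < μ := by linarith [le_max_right K 1]
    have hc := (hsc μ hμ0).one_le_time h1
    have hlog := (hsc μ hμ0).le_log_time_one h.norm_zero (h.hasDeriv 0 hk) hK
      ((le_max_left _ _).trans hμ) hμ0
    have hexp : Real.exp (μ - 1 - K) ≤ c μ 1 := by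
      rwa [← Real.le_log_iff_exp_le (by linarith)]
    have hle := (hsc μ hμ0).norm_space_le h1
    have hsq := (hsc μ hμ0).time_sq h1
    -- For `s ≠ 0` the norm is `1 - |s| / c`, and `c ≤ 1 + |s|` on the hyperboloid.
    have hinv : ‖‖s μ 1‖⁻¹ • s μ 1 - (c μ 1)⁻¹ • s μ 1‖ ≤ (c μ 1)⁻¹ := by
      rcases eq_or_ne (s μ 1) 0 with h0 | h0
      · simp only [h0, smul_zero, sub_zero, _root_.norm_zero]
        exact inv_nonneg.2 (by linarith)
      · have hs : 0 < ‖s μ 1‖ := norm_pos_iff.2 h0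
        have hi : (c μ 1)⁻¹ ≤ ‖s μ 1‖⁻¹ := inv_anti₀ hs hle
        rw [← sub_smul, norm_smul, Real.norm_of_nonneg (sub_nonneg.2 hi), sub_mul,
          inv_mul_cancel₀ hs.ne', sub_le_iff_le_add, ← mul_one_add, ← div_eq_inv_mul,
          le_div_iff₀ (by linarith)]
        nlinarith
    rw [norm_smul, Real.norm_of_nonneg (by positivity)]
    calc μ ^ n * ‖‖s μ 1‖⁻¹ • s μ 1 - (c μ 1)⁻¹ • s μ 1‖
        ≤ μ ^ n * (Real.exp (μ - 1 - K))⁻¹ := by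
          gcongr
          exact hinv.trans (inv_anti₀ (Real.exp_pos _) hexp)
      _ = Real.exp (1 + K) * (μ ^ n / Real.exp (1 * μ)) := by
          rw [← Real.exp_neg, one_mul, div_eq_mul_inv, ← Real.exp_neg, mul_left_comm,
            ← Real.exp_add]
          congr 2
          ring
  have := hd.add (h.tendsto_rem_one hk hsc hn)
  rw [zero_add] at this
  refine this.congr fun μ => ?_
  rw [← smul_add, sub_add_sub_cancel]

/-- The hyperbolic distance from the base point grows like `μ`. -/
theorem tendsto_arcosh_div (h : IsRiccatiExpansion A A' k) (hk : 0 < k) {s : ℝ → ℝ → F}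
    {c : ℝ → ℝ → ℝ} (hsc : ∀ μ, 0 < μ → IsHypCurve (A 0) μ (s μ) (c μ)) :
    Tendsto (fun μ : ℝ => Real.arcosh (c μ 1) / μ) atTop (𝓝 1) := by
  obtain ⟨K, hK⟩ := h.exists_norm_deriv_zero_le hk
  have h1 : (1 : ℝ) ∈ Icc (0 : ℝ) 1 := ⟨zero_le_one, le_rfl⟩
  have hlo : Tendsto (fun μ : ℝ => 1 - (1 + K) / μ) atTop (𝓝 1) := by
    simpa using ((tendsto_const_nhds (x := 1 + K)).div_atTop tendsto_id).const_sub 1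
  have hup : Tendsto (fun μ : ℝ => 1 + Real.log 2 / μ) atTop (𝓝 1) := by
    simpa using ((tendsto_const_nhds (x := Real.log 2)).div_atTop tendsto_id).const_add 1
  -- `arcosh c = log (c + √(c² - 1))` lies between `log c` and `log (2c)`.
  refine tendsto_of_tendsto_of_tendsto_of_le_of_le' hlo hup ?_ ?_
  all_goals
    filter_upwards [eventually_ge_atTop (max K 1)] with μ hμ
    have hμ0 : 0 < μ := by linarith [le_max_right K 1]
    have hc := (hsc μ hμ0).one_le_time h1
  · have hlog := (hsc μ hμ0).le_log_time_one h.norm_zero (h.hasDeriv 0 hk) hK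
      ((le_max_left _ _).trans hμ) hμ0
    have hle : Real.log (c μ 1) ≤ Real.arcosh (c μ 1) := by
      refine Real.log_le_log (by linarith) ?_
      linarith [Real.sqrt_nonneg (c μ 1 ^ 2 - 1)]
    rw [one_sub_div hμ0.ne']
    gcongr
    linarith
  · have hlog := (hsc μ hμ0).log_time_one_le h.norm_zero hμ0.le
    have hle : Real.arcosh (c μ 1) ≤ Real.log 2 + Real.log (c μ 1) := by
      rw [← Real.log_mul (by norm_num) (by linarith)]
      have hsq : √(c μ 1 ^ 2 - 1) ≤ c μ 1 :=
        Real.sqrt_le_iff.2 ⟨by linarith, by linarith⟩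
      refine Real.log_le_log ?_ (by linarith)
      linarith [Real.sqrt_nonneg (c μ 1 ^ 2 - 1)]
    rw [one_add_div hμ0.ne']
    gcongr
    linarith

end IsRiccatiExpansion

end Asymptotics

/-! ### Recovery of the derivatives from the coefficients. -/

section Recovery

variable {d : ℕ}

/-- For a unit vector, `x xᵀ` is idempotent. -/
theorem inv_one_add_vecMulVec {x : E d} (hx : ‖x‖ = 1) :
    (1 + Matrix.vecMulVec (fun i => x i) (fun i => x i) : Matrix (Fin d) (Fin d) ℝ)⁻¹ =
      1 - (1 / 2 : ℝ) • Matrix.vecMulVec (fun i => x i) (fun i => x i) := by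
  have hdot : (fun i => x i) ⬝ᵥ (fun i => x i) = 1 := by
    have h := real_inner_self_eq_norm_sq x
    rw [hx, PiLp.inner_apply] at h
    simpa [dotProduct, sq] using h
  refine Matrix.inv_eq_right_inv ?_
  rw [add_mul, one_mul, mul_sub, mul_one, mul_smul_comm, Matrix.vecMulVec_mul_vecMulVec, hdot,
    one_smul]
  module

theorem toEuclideanLin_inv_one_add_vecMulVec {x : E d} (hx : ‖x‖ = 1) (y : E d) :
    Matrix.toEuclideanLin
      (1 + Matrix.vecMulVec (fun i => x i) (fun i => x i) : Matrix (Fin d) (Fin d) ℝ)⁻¹ y =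
      y - (1 / 2 * inner ℝ x y : ℝ) • x := by
  rw [inv_one_add_vecMulVec hx]
  ext i
  simp only [Matrix.toLpLin_apply, Matrix.sub_mulVec, Matrix.one_mulVec, Matrix.smul_mulVec,
    Matrix.vecMulVec_mulVec, PiLp.inner_apply, PiLp.sub_apply, PiLp.smul_apply, Pi.sub_apply,
    Pi.smul_apply, dotProduct]
  simp [mul_comm, mul_left_comm]

/-- The polynomial that gives the `i`-th coordinate of `Aₙ'` in terms of `A₀, …, A_{n+1}`. -/
def derivPoly (v : ℕ × Fin d) : MvPolynomial (ℕ × Fin d) ℝ :=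
  -∑ r ∈ Finset.range (v.1 + 2),
    (∑ j : Fin d, MvPolynomial.X (0, j) * MvPolynomial.X (v.1 + 1 - r, j)) *
      MvPolynomial.X (r, v.2)

/-- The polynomials that recover the derivatives of `A₀` from `A₀, A₁, …`. -/
def recoveryPoly : ℕ → Fin d → MvPolynomial (ℕ × Fin d) ℝ
  | 0, i => MvPolynomial.X (0, i)
  | m + 1, i => MvPolynomial.mkDerivation ℝ derivPoly (recoveryPoly m i)

theorem X_mem_supported {m n : ℕ} (h : n ≤ m) (i : Fin d) :
    (MvPolynomial.X (n, i) : MvPolynomial (ℕ × Fin d) ℝ) ∈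
      MvPolynomial.supported ℝ {v : ℕ × Fin d | v.1 ≤ m} :=
  MvPolynomial.X_mem_supported.2 h

theorem derivPoly_mem_supported {m : ℕ} {v : ℕ × Fin d} (h : v.1 ≤ m) :
    derivPoly v ∈ MvPolynomial.supported ℝ {v : ℕ × Fin d | v.1 ≤ m + 1} := by
  refine neg_mem (sum_mem fun r hr => mul_mem (sum_mem fun j _ => mul_mem ?_ ?_) ?_)
  all_goals
    have := Finset.mem_range.1 hr
    exact X_mem_supported (by omega) _

/-- The derivation models `d/dt` and raises the largest index by at most one; hence the `m`-th
polynomial involves only `A₀, …, A_m`. -/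
theorem mkDerivation_derivPoly_mem_supported {m : ℕ} {p : MvPolynomial (ℕ × Fin d) ℝ}
    (hp : p ∈ MvPolynomial.supported ℝ {v : ℕ × Fin d | v.1 ≤ m}) :
    MvPolynomial.mkDerivation ℝ derivPoly p ∈
      MvPolynomial.supported ℝ {v : ℕ × Fin d | v.1 ≤ m + 1} := by
  have hmono : MvPolynomial.supported ℝ {v : ℕ × Fin d | v.1 ≤ m} ≤
      MvPolynomial.supported ℝ {v : ℕ × Fin d | v.1 ≤ m + 1} :=
    MvPolynomial.supported_mono fun v (hv : v.1 ≤ m) => hv.trans m.le_succ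
  induction hp using Algebra.adjoin_induction with
  | mem p hp =>
    obtain ⟨v, hv, rfl⟩ := hp
    rw [MvPolynomial.mkDerivation_X]
    exact derivPoly_mem_supported hv
  | algebraMap r =>
    rw [Derivation.map_algebraMap]
    exact zero_mem _
  | add p q _ _ hp hq =>
    rw [map_add]
    exact add_mem hp hq
  | mul p q hp' hq' hp hq =>
    rw [Derivation.leibniz, smul_eq_mul, smul_eq_mul]
    exact add_mem (mul_mem (hmono hp') hq) (mul_mem (hmono hq') hp)

theorem recoveryPoly_mem_supported (m : ℕ) (i : Fin d) :
    recoveryPoly m i ∈ MvPolynomial.supported ℝ {v : ℕ × Fin d | v.1 ≤ m} := by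
  induction m with
  | zero => exact X_mem_supported le_rfl i
  | succ m ih => exact mkDerivation_derivPoly_mem_supported ih

namespace IsRiccatiExpansion

variable {A A' : ℕ → ℝ → E d} {k : ℕ}

theorem eval_derivPoly (h : IsRiccatiExpansion A A' k) {v : ℕ × Fin d} (hv : v.1 < k) {t : ℝ}
    (ht : t ∈ Icc (0 : ℝ) 1) :
    MvPolynomial.eval (fun v : ℕ × Fin d => A v.1 t v.2) (derivPoly v) = A' v.1 t v.2 := by
  rw [eq_neg_of_add_eq_zero_left (h.recursion v.1 hv t ht)]
  simp [derivPoly, PiLp.inner_apply, mul_comm]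

/-- Evaluation along the coefficients intertwines the formal derivation with `d/dt`: this holds on
variables by the recursion, and both sides obey the Leibniz rule. -/
theorem hasDerivWithinAt_eval (h : IsRiccatiExpansion A A' k) {m : ℕ} (hm : m < k)
    {p : MvPolynomial (ℕ × Fin d) ℝ}
    (hp : p ∈ MvPolynomial.supported ℝ {v : ℕ × Fin d | v.1 ≤ m}) {t : ℝ}
    (ht : t ∈ Icc (0 : ℝ) 1) :
    HasDerivWithinAt (fun t => MvPolynomial.eval (fun v : ℕ × Fin d => A v.1 t v.2) p)
      (MvPolynomial.eval (fun v : ℕ × Fin d => A v.1 t v.2)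
        (MvPolynomial.mkDerivation ℝ derivPoly p)) (Icc 0 1) t := by
  induction hp using Algebra.adjoin_induction with
  | mem p hp =>
    obtain ⟨v, hv, rfl⟩ := hp
    have hv' : v.1 < k := lt_of_le_of_lt hv hm
    rw [MvPolynomial.mkDerivation_X, h.eval_derivPoly hv' ht]
    simp only [MvPolynomial.eval_X]
    exact (EuclideanSpace.proj v.2 : E d →L[ℝ] ℝ).hasFDerivAt.comp_hasDerivWithinAt t
      (h.hasDeriv v.1 hv' t ht)
  | algebraMap r =>
    rw [Derivation.map_algebraMap, map_zero]
    simp only [MvPolynomial.algebraMap_eq, MvPolynomial.eval_C]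
    exact hasDerivWithinAt_const t (Icc 0 1) r
  | add p q _ _ hp hq =>
    simp only [map_add]
    exact hp.add hq
  | mul p q _ _ hp hq =>
    simp only [Derivation.leibniz, smul_eq_mul, map_add, map_mul]
    exact (hp.mul hq).congr_deriv (by ring)

/-- The vector whose coordinates are the values of the recovery polynomials. -/
theorem hasDerivWithinAt_recoveryPoly (h : IsRiccatiExpansion A A' k) {m : ℕ} (hm : m < k) {t : ℝ}
    (ht : t ∈ Icc (0 : ℝ) 1) :
    HasDerivWithinAt (fun t => (WithLp.toLp 2 fun i =>
        MvPolynomial.eval (fun v : ℕ × Fin d => A v.1 t v.2) (recoveryPoly m i) : E d))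
      (WithLp.toLp 2 fun i =>
        MvPolynomial.eval (fun v : ℕ × Fin d => A v.1 t v.2) (recoveryPoly (m + 1) i))
      (Icc 0 1) t :=
  (PiLp.continuousLinearEquiv 2 ℝ
    fun _ : Fin d => ℝ).symm.toContinuousLinearMap.hasFDerivAt.comp_hasDerivWithinAt t
      (hasDerivWithinAt_pi.2 fun i =>
        h.hasDerivWithinAt_eval hm (recoveryPoly_mem_supported m i) ht)

theorem iteratedDerivWithin_eq (h : IsRiccatiExpansion A A' k) {f : ℝ → E d} {L : ℝ}
    (hf : ∀ t ∈ Icc (0 : ℝ) 1, f t = L • A 0 t) {m : ℕ} (hm : m ≤ k) {t : ℝ}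
    (ht : t ∈ Icc (0 : ℝ) 1) :
    iteratedDerivWithin m f (Icc 0 1) t = L • (WithLp.toLp 2 fun i =>
      MvPolynomial.eval (fun v : ℕ × Fin d => A v.1 t v.2) (recoveryPoly m i) : E d) := by
  induction m generalizing t with
  | zero =>
    rw [iteratedDerivWithin_zero, hf t ht]
    simp [recoveryPoly]
  | succ m ih =>
    rw [iteratedDerivWithin_succ, derivWithin_congr (fun t ht => ih (by omega) ht)
      (ih (by omega) ht)]
    exact ((h.hasDerivWithinAt_recoveryPoly hm ht).const_smul L).derivWithin
      (uniqueDiffOn_Icc zero_lt_one t ht)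

end IsRiccatiExpansion

/-! ### Application to paths at natural parametrization. -/

namespace IsNaturalPath

variable {γ γ' : ℝ → E d} {k : ℕ}

theorem contDiffOn_velocity (h : IsNaturalPath (k + 1) γ) :
    ContDiffOn ℝ k (velocity γ) (Icc 0 1) :=
  h.contDiffOn.derivWithin (uniqueDiffOn_Icc zero_lt_one) (by norm_cast)

theorem norm_tangent (h : IsNaturalPath k γ) (hL : 0 < pathLength γ) {t : ℝ}
    (ht : t ∈ Icc (0 : ℝ) 1) : ‖tangent γ t‖ = 1 := by
  rw [tangent, norm_smul, h.speed t ht, norm_inv, Real.norm_of_nonneg hL.le, inv_mul_cancel₀ hL.ne']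

theorem contDiffOn_tangent (h : IsNaturalPath (k + 1) γ) :
    ContDiffOn ℝ k (tangent γ) (Icc 0 1) :=
  h.contDiffOn_velocity.const_smul _

theorem coeffA_succ (h : IsNaturalPath k γ) (hL : 0 < pathLength γ) {t : ℝ}
    (ht : t ∈ Icc (0 : ℝ) 1) (n : ℕ) {D : E d}
    (hD : D = derivWithin (coeffA γ n) (Icc 0 1) t +
      ∑ j : Fin n, (inner ℝ (tangent γ t) (coeffA γ (n - j) t)) • coeffA γ (j + 1) t) :
    coeffA γ (n + 1) t = -(D - (1 / 2 * inner ℝ (tangent γ t) D : ℝ) • tangent γ t) := by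
  rw [coeffA]
  beta_reduce
  rw [← hD, projMat, toEuclideanLin_inv_one_add_vecMulVec (h.norm_tangent hL ht)]

/-- Each step of the recursion costs one derivative. -/
theorem contDiffOn_coeffA (h : IsNaturalPath (k + 1) γ) (hL : 0 < pathLength γ) {n : ℕ}
    (hn : n ≤ k) : ContDiffOn ℝ (k - n : ℕ) (coeffA γ n) (Icc 0 1) := by
  induction n using Nat.strong_induction_on with
  | _ n ih =>
    rcases n with _ | n
    · exact h.contDiffOn_tangent.congr fun t _ => by rw [coeffA]
    · have hle : ∀ m, m ≤ n + 1 → ((k - (n + 1) : ℕ) : WithTop ℕ∞) ≤ (k - m : ℕ) := fun m hm => by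
        norm_cast
        omega
      have hθ : ContDiffOn ℝ (k - (n + 1) : ℕ) (tangent γ) (Icc 0 1) :=
        h.contDiffOn_tangent.of_le (hle 0 (by omega))
      have hD : ContDiffOn ℝ (k - (n + 1) : ℕ) (fun t => derivWithin (coeffA γ n) (Icc 0 1) t +
          ∑ j : Fin n, (inner ℝ (tangent γ t) (coeffA γ (n - j) t)) • coeffA γ (j + 1) t)
          (Icc 0 1) := by
        refine ((ih n (by omega) (by omega)).derivWithin (uniqueDiffOn_Icc zero_lt_one) ?_).add
          (ContDiffOn.sum fun j _ => ?_)
        · norm_cast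
          omega
        · exact (hθ.inner ℝ ((ih (n - j) (by omega) (by omega)).of_le (hle _ (by omega)))).smul
            ((ih (j + 1) (by omega) (by omega)).of_le (hle _ (by omega)))
      exact (hD.sub ((contDiffOn_const.mul (hθ.inner ℝ hD)).smul hθ)).neg.congr
        fun t ht => h.coeffA_succ hL ht n rfl

/-- The two extreme summands of the recursion are `⟨θ, A_{n+1}⟩ θ` and `A_{n+1}`; together they form
`P A_{n+1}`, which the definition of `coeffA` inverts. -/
theorem isRiccatiExpansion (h : IsNaturalPath (k + 1) γ) (hL : 0 < pathLength γ) :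
    IsRiccatiExpansion (coeffA γ) (fun n => derivWithin (coeffA γ n) (Icc 0 1)) k where
  norm_zero t ht := by
    rw [coeffA]
    exact h.norm_tangent hL ht
  continuousOn n hn := (h.contDiffOn_coeffA hL hn).continuousOn
  hasDeriv n hn t ht :=
    ((h.contDiffOn_coeffA hL hn.le).differentiableOn (by
      norm_cast
      omega) t ht).hasDerivWithinAt
  recursion n hn t ht := by
    have hs := h.coeffA_succ hL ht n rfl
    have hone : inner ℝ (tangent γ t) (tangent γ t) = 1 := by
      rw [real_inner_self_eq_norm_sq, h.norm_tangent hL ht, one_pow]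
    rw [Finset.sum_range_succ, Finset.sum_range_succ', Nat.sub_self, show coeffA γ 0 = tangent γ by
      rw [coeffA], hone]
    simp only [Nat.add_sub_add_right, Nat.sub_zero]
    rw [Fin.sum_univ_eq_sum_range (fun j =>
      (inner ℝ (tangent γ t) (coeffA γ (n - j) t)) • coeffA γ (j + 1) t) n] at hs
    generalize ∑ j ∈ Finset.range n,
      (inner ℝ (tangent γ t) (coeffA γ (n - j) t)) • coeffA γ (j + 1) t = S at *
    rw [hs, inner_neg_right, inner_sub_right, inner_smul_right, hone]
    module

/-- The freedom in `θ` and `μ` serves three cases: the unit tangent, the raw velocity with `μ = l`,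
and `θ = 0` for a path of length zero. -/
theorem isHypCurve (h : IsNaturalPath (k + 1) γ) {θ : ℝ → E d} {l μ : ℝ}
    (hθ : ∀ t ∈ Icc (0 : ℝ) 1, l • velocity γ t = μ • θ t) :
    IsHypCurve θ μ (hypSpace γ l) (hypTime γ l) where
  space_zero := hypSpace_zero l
  time_zero := hypTime_zero l
  space_deriv t ht :=
    (hasDerivWithinAt_hypSpace h.contDiffOn_velocity.continuousOn l ht).congr_deriv (by
      rw [hθ t ht, smul_smul, mul_comm])
  time_deriv t ht :=
    (hasDerivWithinAt_hypTime h.contDiffOn_velocity.continuousOn l ht).congr_deriv (by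
      rw [hθ t ht, real_inner_smul_left])

theorem isHypCurve_coeffA (h : IsNaturalPath (k + 1) γ) (μ : ℝ) :
    IsHypCurve (coeffA γ 0) μ (hypSpace γ (μ / pathLength γ)) (hypTime γ (μ / pathLength γ)) :=
  h.isHypCurve fun t _ => by
    rw [coeffA, tangent, smul_smul, div_eq_mul_inv]

theorem endPoint_eq (h : IsNaturalPath (k + 1) γ) (l : ℝ) :
    endPoint (signature γ) l =
      Sum.elim (fun i => polarDirection (endPoint (signature γ) l) i *
          Real.sinh (polarRadius (endPoint (signature γ) l)))
        (fun _ => Real.cosh (polarRadius (endPoint (signature γ) l))) := by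
  have h1 : (1 : ℝ) ∈ Icc (0 : ℝ) 1 := ⟨zero_le_one, le_rfl⟩
  have hc := h.isHypCurve (θ := velocity γ) (l := l) (μ := l) fun _ _ => rfl
  rw [endPoint_signature h.contDiffOn_velocity.continuousOn]
  have hr : polarRadius (hypPoint γ l 1) = Real.arcosh (hypTime γ l 1) := rfl
  have hdir : polarDirection (hypPoint γ l 1) = ‖hypSpace γ l 1‖⁻¹ • hypSpace γ l 1 := rfl
  have hsinh : Real.sinh (polarRadius (hypPoint γ l 1)) = ‖hypSpace γ l 1‖ := by
    rw [hr, Real.sinh_arcosh (hc.one_le_time h1), hc.time_sq h1, add_sub_cancel_left,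
      Real.sqrt_sq (norm_nonneg _)]
  funext a
  rcases a with i | u
  · rw [Sum.elim_inl, hsinh, hdir, PiLp.smul_apply, smul_eq_mul]
    change hypSpace γ l 1 i = _
    rcases eq_or_ne (hypSpace γ l 1) 0 with h0 | h0
    · simp [h0]
    · have := norm_ne_zero_iff.2 h0
      field_simp
  · rw [Sum.elim_inr, hr, Real.cosh_arcosh (hc.one_le_time h1)]
    rfl

theorem tendsto_polarRadius_div (h : IsNaturalPath (k + 1) γ) (hk : 1 ≤ k)
    (hL : 0 < pathLength γ) :
    Tendsto (fun l : ℝ => polarRadius (endPoint (signature γ) l) / l) atTop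
      (𝓝 (pathLength γ)) := by
  have hlim := (((h.isRiccatiExpansion hL).tendsto_arcosh_div hk
    (fun μ _ => h.isHypCurve_coeffA μ)).comp (tendsto_id.atTop_mul_const hL)).mul_const
      (pathLength γ)
  rw [one_mul] at hlim
  refine hlim.congr fun l => ?_
  rw [endPoint_signature h.contDiffOn_velocity.continuousOn]
  simp only [Function.comp, id, mul_div_cancel_right₀ _ hL.ne']
  change Real.arcosh (hypTime γ l 1) / (l * pathLength γ) * pathLength γ =
    Real.arcosh (hypTime γ l 1) / l
  field_simp

theorem tendsto_polarDirection (h : IsNaturalPath (k + 1) γ) (hk : 1 ≤ k)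
    (hL : 0 < pathLength γ) {n : ℕ} (hn : n ≤ k) :
    Tendsto (fun l : ℝ => (l * pathLength γ) ^ n • (polarDirection (endPoint (signature γ) l) -
        ∑ j ∈ Finset.range n, ((l * pathLength γ) ^ j)⁻¹ • coeffA γ j 1))
      atTop (𝓝 (coeffA γ n 1)) := by
  refine (((h.isRiccatiExpansion hL).tendsto_direction hk
    (fun μ _ => h.isHypCurve_coeffA μ) hn).comp (tendsto_id.atTop_mul_const hL)).congr
      fun l => ?_
  rw [endPoint_signature h.contDiffOn_velocity.continuousOn]
  simp only [Function.comp, id, mul_div_cancel_right₀ _ hL.ne']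
  rfl

theorem iteratedDerivWithin_succ_one (h : IsNaturalPath (k + 1) γ) (hL : 0 < pathLength γ) {m : ℕ}
    (hm : m ≤ k) (i : Fin d) :
    iteratedDerivWithin (m + 1) γ (Icc 0 1) 1 i = pathLength γ *
      MvPolynomial.eval (fun v : ℕ × Fin d => coeffA γ v.1 1 v.2) (recoveryPoly m i) := by
  rw [iteratedDerivWithin_succ', (h.isRiccatiExpansion hL).iteratedDerivWithin_eq
    (f := derivWithin γ (Icc 0 1)) (L := pathLength γ) (fun t _ => ?_) hm ⟨zero_le_one, le_rfl⟩]
  · rfl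
  · rw [coeffA, tangent, smul_inv_smul₀ hL.ne']
    rfl

/-- Without a unit tangent there is no expansion, but the development stays at the base point. This
lets the signature detect length zero. -/
theorem tendsto_polarRadius_div_of_pathLength_eq_zero (h : IsNaturalPath (k + 1) γ)
    (hL : pathLength γ = 0) :
    Tendsto (fun l : ℝ => polarRadius (endPoint (signature γ) l) / l) atTop (𝓝 0) := by
  refine tendsto_const_nhds.congr fun l => ?_
  have hc := h.isHypCurve (θ := fun _ => (0 : E d)) (l := l) (μ := 0) fun t ht => by
    rw [norm_eq_zero.1 ((h.speed t ht).trans hL), smul_zero, smul_zero]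
  have hlog : hypTime γ l 1 ≤ 1 := by
    have := antitoneOn_Icc_of_hasDerivWithinAt hc.time_deriv (fun t _ => by simp)
      (⟨le_rfl, zero_le_one⟩ : (0 : ℝ) ∈ Icc (0 : ℝ) 1) ⟨zero_le_one, le_rfl⟩ zero_le_one
    rwa [hc.time_zero] at this
  have hone : hypTime γ l 1 = 1 := hlog.antisymm (hc.one_le_time ⟨zero_le_one, le_rfl⟩)
  rw [endPoint_signature h.contDiffOn_velocity.continuousOn]
  change 0 = Real.arcosh (hypTime γ l 1) / l
  simp [hone]

/-- The signature determines the length. -/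
theorem pathLength_eq (h : IsNaturalPath (k + 1) γ) (h' : IsNaturalPath (k + 1) γ') (hk : 1 ≤ k)
    (hX : signature γ = signature γ') : pathLength γ = pathLength γ' := by
  have key : ∀ {γ : ℝ → E d}, IsNaturalPath (k + 1) γ →
      Tendsto (fun l : ℝ => polarRadius (endPoint (signature γ) l) / l) atTop
        (𝓝 (pathLength γ)) := fun {γ} h => by
    rcases (show 0 ≤ pathLength γ from ENNReal.toReal_nonneg).eq_or_lt with hL | hL
    · rw [← hL]
      exact h.tendsto_polarRadius_div_of_pathLength_eq_zero hL.symm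
    · exact h.tendsto_polarRadius_div hk hL
  have h1 := key h
  rw [hX] at h1
  exact tendsto_nhds_unique h1 (key h')

/-- The signature determines the coefficients of the expansion at the end point. -/
theorem coeffA_one_eq (h : IsNaturalPath (k + 1) γ) (h' : IsNaturalPath (k + 1) γ') (hk : 1 ≤ k)
    (hL : 0 < pathLength γ) (hX : signature γ = signature γ') {n : ℕ} (hn : n ≤ k) :
    coeffA γ n 1 = coeffA γ' n 1 := by
  induction n using Nat.strong_induction_on with
  | _ n ih =>
    have hLL := h.pathLength_eq h' hk hX
    refine tendsto_nhds_unique (h.tendsto_polarDirection hk hL hn)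
      ((h'.tendsto_polarDirection hk (hLL ▸ hL) hn).congr fun l => ?_)
    have hs : ∑ j ∈ Finset.range n, ((l * pathLength γ') ^ j)⁻¹ • coeffA γ j 1 =
        ∑ j ∈ Finset.range n, ((l * pathLength γ') ^ j)⁻¹ • coeffA γ' j 1 :=
      Finset.sum_congr rfl fun j hj => by
        rw [ih j (Finset.mem_range.1 hj) ((Finset.mem_range.1 hj).le.trans hn)]
    rw [hX, hLL, hs]

theorem iteratedDerivWithin_eq_zero (h : IsNaturalPath k γ) (hL : pathLength γ = 0) (m : ℕ) {t : ℝ}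
    (ht : t ∈ Icc (0 : ℝ) 1) : iteratedDerivWithin (m + 1) γ (Icc 0 1) t = 0 := by
  have hv : EqOn (derivWithin γ (Icc 0 1)) (fun _ => 0) (Icc 0 1) := fun t ht =>
    norm_eq_zero.1 ((h.speed t ht).trans hL)
  rw [iteratedDerivWithin_succ', iteratedDerivWithin_congr hv ht, iteratedDerivWithin_const]
  simp

theorem iteratedDerivWithin_one_eq (h : IsNaturalPath (k + 1) γ) (h' : IsNaturalPath (k + 1) γ')
    (hk : 1 ≤ k) (hX : signature γ = signature γ') {m : ℕ} (hm : m ≤ k) :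
    iteratedDerivWithin (m + 1) γ (Icc 0 1) 1 = iteratedDerivWithin (m + 1) γ' (Icc 0 1) 1 := by
  have h1 : (1 : ℝ) ∈ Icc (0 : ℝ) 1 := ⟨zero_le_one, le_rfl⟩
  have hLL := h.pathLength_eq h' hk hX
  rcases (show 0 ≤ pathLength γ from ENNReal.toReal_nonneg).eq_or_lt with hL | hL
  · rw [h.iteratedDerivWithin_eq_zero hL.symm m h1,
      h'.iteratedDerivWithin_eq_zero (hLL ▸ hL.symm) m h1]
  · ext i
    rw [h.iteratedDerivWithin_succ_one hL hm, h'.iteratedDerivWithin_succ_one (hLL ▸ hL) hm, hLL]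
    congr 1
    -- Only variables of index at most `m ≤ k` occur, and there the coefficients of the two paths
    -- agree.
    refine MvPolynomial.eval₂Hom_congr' rfl (fun v hv _ => ?_) rfl
    have := MvPolynomial.mem_supported.1 (recoveryPoly_mem_supported m i) hv
    rw [h.coeffA_one_eq h' hk hL hX (le_trans this hm)]

end IsNaturalPath

end Recovery

end HypSig

end

theorem mainTheorem5 (d : ℕ) :
    (∀ (k : ℕ), 1 ≤ k → ∀ γ γ' : ℝ → HypSig.E d,
      HypSig.IsNaturalPath (k + 1) γ → HypSig.IsNaturalPath (k + 1) γ' →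
      HypSig.signature γ = HypSig.signature γ' →
      ∀ m : ℕ, 1 ≤ m → m ≤ k + 1 →
        iteratedDerivWithin m γ (Icc 0 1) 1 = iteratedDerivWithin m γ' (Icc 0 1) 1) ∧
    (∃ Q : ℕ → Fin d → MvPolynomial (ℕ × Fin d) ℝ,
      (∀ m i, ∀ v ∈ (Q m i).vars, v.1 ≤ m) ∧
      ∀ (k : ℕ), 1 ≤ k → ∀ γ : ℝ → HypSig.E d,
        HypSig.IsNaturalPath (k + 1) γ → 0 < HypSig.pathLength γ →
        (∀ l : ℝ, 0 < l →
          Summable (HypSig.endTerm (HypSig.signature γ) l) ∧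
          (∃ Γ, HypSig.IsCartanDevelopment (fun t => l • γ t) Γ) ∧
          (∀ Γ, HypSig.IsCartanDevelopment (fun t => l • γ t) Γ →
            Γ 1 *ᵥ HypSig.basePoint d = HypSig.endPoint (HypSig.signature γ) l) ∧
          HypSig.endPoint (HypSig.signature γ) l =
            Sum.elim
              (fun i => HypSig.polarDirection (HypSig.endPoint (HypSig.signature γ) l) i *
                Real.sinh (HypSig.polarRadius (HypSig.endPoint (HypSig.signature γ) l)))
              (fun _ =>
                Real.cosh (HypSig.polarRadius (HypSig.endPoint (HypSig.signature γ) l)))) ∧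
        Tendsto (fun l : ℝ =>
            HypSig.polarRadius (HypSig.endPoint (HypSig.signature γ) l) / l)
          atTop (𝓝 (HypSig.pathLength γ)) ∧
        (∀ n : ℕ, n ≤ k →
          Tendsto (fun l : ℝ => (l * HypSig.pathLength γ) ^ n •
              (HypSig.polarDirection (HypSig.endPoint (HypSig.signature γ) l) -
                ∑ j ∈ Finset.range n,
                  ((l * HypSig.pathLength γ) ^ j)⁻¹ • HypSig.coeffA γ j 1))
            atTop (𝓝 (HypSig.coeffA γ n 1))) ∧
        (∀ m : ℕ, m ≤ k → ∀ i : Fin d,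
          iteratedDerivWithin (m + 1) γ (Icc 0 1) 1 i =
            HypSig.pathLength γ *
              MvPolynomial.eval (fun v : ℕ × Fin d => HypSig.coeffA γ v.1 1 v.2) (Q m i))) := by
  refine ⟨fun k hk γ γ' h h' hX m hm1 hm => ?_, HypSig.recoveryPoly, fun m i v hv =>
    MvPolynomial.mem_supported.1 (HypSig.recoveryPoly_mem_supported m i) hv,
    fun k hk γ h hL => ⟨fun l _ => ?_, h.tendsto_polarRadius_div hk hL,
      fun n hn => h.tendsto_polarDirection hk hL hn,
      fun m hm i => h.iteratedDerivWithin_succ_one hL hm i⟩⟩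
  · obtain ⟨m, rfl⟩ := Nat.exists_eq_add_of_le' hm1
    exact h.iteratedDerivWithin_one_eq h' hk hX (by omega)
  · have hv := h.contDiffOn_velocity.continuousOn
    refine ⟨(HypSig.hasSum_endTerm hv l).summable, HypSig.exists_isCartanDevelopment hv l,
      fun Γ hΓ => ?_, h.endPoint_eq l⟩
    rw [HypSig.endPoint_signature hv]
    exact hΓ.mulVec_basePoint hv ⟨zero_le_one, le_rfl⟩
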